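/- Identify $\mathbb{C}^2$ with $\mathbb{R}^4$ via $z_j = x_j + i y_j$ and let $\omega_0 = dx_1\wedge dy_1 + dx_2\wedge dy_2$. A symplectic embedding of an open set $U \subset \mathbb{C}^2$ into $V \subset \mathbb{C}^2$ is a smooth embedding $\varphi\colon U \hookrightarrow \mathbb{C}^2$ with $\varphi(U)\subset V$ and $\varphi^*\omega_0=\omega_0$. For $a, A>0$ let \[ P(\pi,a)=\{(z_1,z_2)\in\mathbb{C}^2 : \pi|z_1|^2<\pi,\ \pi|z_2|^2<a\},\qquad B^4(A)=\{(z_1,z_2)\in\mathbb{C}^2 : \pi|z_1|^2+\pi|z_2|^2<A\}. \] Every $a > 2\pi$ satisfies $2(k^2-k+1) < a/\pi \le 2(k^2+k+1)$ for exactly one integer $k\ge 1$; with this $k$ put \[ s_{PB}(a) = \frac{a-2\pi}{2k}+(k+2)\pi . \] Then for every $a>2\pi$ and every $\epsilon>0$ there is a symplectic embedding of $P(\pi,a)$ into $B^4(s_{PB}(a)+\epsilon)$. -/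

import Mathlib

open scoped Real ContDiff

/-- The standard symplectic form `ω₀ = ∑ᵢ dxᵢ ∧ dyᵢ` on `ℂⁿ = ℝ²ⁿ`, with `zᵢ = xᵢ + i yᵢ`. -/
def stdSymplecticForm {n : ℕ} (v w : Fin n → ℂ) : ℝ :=
  ∑ i, ((v i).re * (w i).im - (v i).im * (w i).re)

/-- `φ`, restricted to the open set `U ⊆ ℂⁿ`, is a symplectic embedding of `U` into `V`:
it is smooth (in the real sense) on `U`, a homeomorphism from `U` onto its image, it satisfies
`φ^* ω₀ = ω₀` on `U`, and `φ(U) ⊆ V`. (It is then an immersion, as `ω₀` is nondegenerate.)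
The values of `φ` outside `U` play no role. -/
structure IsSymplecticEmbedding {n : ℕ} (φ : (Fin n → ℂ) → (Fin n → ℂ))
    (U V : Set (Fin n → ℂ)) : Prop where
  contDiffOn : ContDiffOn ℝ ∞ φ U
  isEmbedding : Topology.IsEmbedding (U.domRestrict φ)
  pullback_eq : ∀ z ∈ U, ∀ v w : Fin n → ℂ,
    stdSymplecticForm (fderiv ℝ φ z v) (fderiv ℝ φ z w) = stdSymplecticForm v w
  mapsTo : Set.MapsTo φ U V

/-- `U` symplectically embeds in `V`. -/
def SymplecticallyEmbeds {n : ℕ} (U V : Set (Fin n → ℂ)) : Prop :=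
  ∃ φ : (Fin n → ℂ) → (Fin n → ℂ), IsSymplecticEmbedding φ U V

/-- The open disc `D(a) ⊆ ℂ` of area `a`, centred at the origin. -/
def openDisc (a : ℝ) : Set ℂ := {z | π * ‖z‖ ^ 2 < a}

/-- The polydisc `P(a₁, …, aₙ) = D(a₁) × ⋯ × D(aₙ)`. -/
def polydisc {n : ℕ} (a : Fin n → ℝ) : Set (Fin n → ℂ) := {z | ∀ i, z i ∈ openDisc (a i)}

/-- The open symplectic ellipsoid `E(a₁, …, aₙ)` with radii `√(aᵢ / π)`. -/
def symplecticEllipsoid {n : ℕ} (a : Fin n → ℝ) : Set (Fin n → ℂ) :=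
  {z | ∑ i, π * ‖z i‖ ^ 2 / a i < 1}

/-- The ball `B²ⁿ(A) = E(A, …, A)`. -/
def symplecticBall (n : ℕ) (A : ℝ) : Set (Fin n → ℂ) := symplecticEllipsoid fun _ => A

/-- The integer `k ≥ 1` satisfies `2(k² - k + 1) < a/π ≤ 2(k² + k + 1)`. -/
def IsFoldIndex (a : ℝ) (k : ℕ) : Prop :=
  1 ≤ k ∧ 2 * ((k : ℝ) ^ 2 - k + 1) < a / π ∧ a / π ≤ 2 * ((k : ℝ) ^ 2 + k + 1)

theorem existsUnique_isFoldIndex {a : ℝ} (ha : 2 * π < a) : ∃! k : ℕ, IsFoldIndex a k := by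
  classical
  have hx : 2 < a / π := by rwa [lt_div_iff₀ Real.pi_pos]
  have hex : ∃ k : ℕ, a / π ≤ 2 * ((k : ℝ) ^ 2 + k + 1) := by
    obtain ⟨k, hk⟩ := exists_nat_ge (a / π)
    exact ⟨k, by nlinarith [sq_nonneg (k : ℝ), (Nat.cast_nonneg k : (0 : ℝ) ≤ k)]⟩
  have huniq : ∀ k m : ℕ, IsFoldIndex a k → IsFoldIndex a m → k ≤ m := by
    rintro k m ⟨-, hk, -⟩ ⟨-, -, hm⟩
    by_contra! h
    have h' : (m : ℝ) + 1 ≤ k := by exact_mod_cast h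
    have hm0 : (0 : ℝ) ≤ m := Nat.cast_nonneg m
    nlinarith
  obtain ⟨m, hm⟩ : ∃ m, Nat.find hex = m + 1 := by
    refine Nat.exists_eq_succ_of_ne_zero fun h0 => ?_
    have := Nat.find_spec hex
    rw [h0] at this
    norm_num at this
    linarith
  have h1 := Nat.find_spec hex
  have h2 := Nat.find_min hex (m := m) (by omega)
  rw [hm] at h1
  have hI : IsFoldIndex a (m + 1) := by
    refine ⟨by omega, ?_, h1⟩
    push Not at h2
    push_cast
    linarith
  exact ⟨m + 1, hI, fun k hk => le_antisymm (huniq _ _ hk hI) (huniq _ _ hI hk)⟩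

open Classical in
/-- The function `s_PB(a) = (a - 2π)/(2k) + (k + 2)π`, where `k` is the integer with
`2(k² - k + 1) < a/π ≤ 2(k² + k + 1)`. Its domain is `a > 2π` (the value is `0` otherwise). -/
noncomputable def sPB (a : ℝ) : ℝ :=
  if h : ∃ k : ℕ, IsFoldIndex a k then
    (a - 2 * π) / (2 * (Nat.find h : ℝ)) + ((Nat.find h : ℝ) + 2) * π
  else 0

theorem sPB_eq {a : ℝ} {k : ℕ} (ha : 2 * π < a) (hk : IsFoldIndex a k) :
    sPB a = (a - 2 * π) / (2 * (k : ℝ)) + ((k : ℝ) + 2) * π := by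
  classical
  have h : ∃ k : ℕ, IsFoldIndex a k := ⟨k, hk⟩
  have : Nat.find h = k := (existsUnique_isFoldIndex ha).unique (Nat.find_spec h) hk
  rw [sPB, dif_pos h, this]

/-! The proof is multiple symplectic folding in action-angle coordinates. On positive actions `u`,
`q`, applying `actionAngle` to both `u + iv` and `q + ip` is symplectic, depends on the angles `v`,
`p` only modulo `1`, and lands in the ball exactly when `u + q < A`. The disc of area `π` is first
mapped into a rectangle of width `w` slightly above `π` and height `1`. The disc of area `a` goes
into a comb `f(p) < q < f(p) + h(p)`: a row of `2k` chambers over `[j, j + 1]`, joined by narrow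
gates that lie at the top for odd `j` and at the bottom for even `j`.

Since `p` is an angle, all chambers wrap onto one interval and must be separated by `u`. Over
chamber `j ≥ 1` a shear raises `u` by `(j - 1)w` at the left gate, growing to `jw` once `q` has
moved a distance `L` from that gate (the stair). The price is a shift of `p` by the derivative of
the stair times `v - v₀` (`symplecticAt_lift`). At a gate both neighbouring pieces are locally the
same translation, so the pieces glue (`rise_at_gate`).

Chambers with indices differing by at least `2` are disjoint in `u`. Neighbours can collide only
where the later stair is incomplete, and the comb is cut so that both reach these `q` only within
`d` of their common gate. There the earlier piece has no shift of `p` and the later one moves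
forward by at most `1 - 2d`, less than a full turn even with both margins added
(`lift_ne_of_floor_lt`).

As `d → 0`, `w` and `L` tend to `π` and the comb has area close to `2kA - 4kπ - 2k²π + 2π`; equating
this with `a` gives `A = s_PB(a)`. The lower bound on `a/π` says that `A > (2k + 1)π`, so that the
last chambers still have room. -/

/-! ### Symplectic maps, pointwise, and how they give embeddings -/

/-- `φ` is smooth at `z` and its differential there preserves the standard symplectic form. -/
def SymplecticAt {n : ℕ} (φ : (Fin n → ℂ) → (Fin n → ℂ)) (z : Fin n → ℂ) : Prop :=
  ContDiffAt ℝ ∞ φ z ∧ ∀ v w : Fin n → ℂ,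
    stdSymplecticForm (fderiv ℝ φ z v) (fderiv ℝ φ z w) = stdSymplecticForm v w

/-- `g` is smooth at `z` and its differential there preserves the area form of the plane. -/
def AreaPreservingAt (g : ℂ → ℂ) (z : ℂ) : Prop :=
  ContDiffAt ℝ ∞ g z ∧ ∀ v w : ℂ,
    (fderiv ℝ g z v).re * (fderiv ℝ g z w).im - (fderiv ℝ g z v).im * (fderiv ℝ g z w).re
      = v.re * w.im - v.im * w.re

theorem SymplecticAt.comp {n : ℕ} {φ ψ : (Fin n → ℂ) → (Fin n → ℂ)} {z : Fin n → ℂ}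
    (hψ : SymplecticAt ψ (φ z)) (hφ : SymplecticAt φ z) : SymplecticAt (ψ ∘ φ) z := by
  refine ⟨hψ.1.comp z hφ.1, fun v w => ?_⟩
  rw [fderiv_comp z (hψ.1.differentiableAt (by simp)) (hφ.1.differentiableAt (by simp))]
  simp only [ContinuousLinearMap.comp_apply]
  rw [hψ.2, hφ.2]

theorem SymplecticAt.congr {n : ℕ} {φ ψ : (Fin n → ℂ) → (Fin n → ℂ)} {z : Fin n → ℂ}
    (hφ : SymplecticAt φ z) (h : ψ =ᶠ[nhds z] φ) : SymplecticAt ψ z := by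
  refine ⟨hφ.1.congr_of_eventuallyEq h, fun v w => ?_⟩
  rw [h.fderiv_eq, hφ.2]

theorem AreaPreservingAt.comp {f g : ℂ → ℂ} {z : ℂ}
    (hg : AreaPreservingAt g (f z)) (hf : AreaPreservingAt f z) : AreaPreservingAt (g ∘ f) z := by
  refine ⟨hg.1.comp z hf.1, fun v w => ?_⟩
  rw [fderiv_comp z (hg.1.differentiableAt (by simp)) (hf.1.differentiableAt (by simp))]
  simp only [ContinuousLinearMap.comp_apply]
  rw [hg.2, hf.2]

theorem SymplecticAt.pi {n : ℕ} {g : Fin n → ℂ → ℂ} {z : Fin n → ℂ}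
    (hg : ∀ i, AreaPreservingAt (g i) (z i)) : SymplecticAt (fun z i => g i (z i)) z := by
  have hd : HasFDerivAt (fun z : Fin n → ℂ => fun i => g i (z i))
      (ContinuousLinearMap.pi fun i =>
        (fderiv ℝ (g i) (z i)).comp (ContinuousLinearMap.proj (R := ℝ) i)) z := by
    refine hasFDerivAt_pi.2 fun i => ?_
    exact ((hg i).1.differentiableAt (by simp)).hasFDerivAt.comp z
      (ContinuousLinearMap.proj (R := ℝ) (φ := fun _ : Fin n => ℂ) i).hasFDerivAt
  refine ⟨contDiffAt_pi.2 fun i => ?_, fun v w => ?_⟩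
  · exact (hg i).1.comp z (contDiff_apply ℝ ℂ i).contDiffAt
  · rw [hd.fderiv]
    simp only [stdSymplecticForm]
    exact Finset.sum_congr rfl fun i _ => (hg i).2 (v i) (w i)

theorem eq_zero_of_stdSymplecticForm {n : ℕ} {v : Fin n → ℂ}
    (h : ∀ w, stdSymplecticForm v w = 0) : v = 0 := by
  classical
  have key : ∀ i (c : ℂ), stdSymplecticForm v (Pi.single i c)
      = (v i).re * c.im - (v i).im * c.re := by
    intro i c
    rw [stdSymplecticForm, Finset.sum_eq_single i]
    · simp
    · intro j _ hj
      simp [Pi.single_eq_of_ne hj]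
    · simp
  funext i
  have h1 := key i Complex.I
  have h2 := key i 1
  rw [h] at h1 h2
  simp at h1 h2
  exact Complex.ext h1.symm h2

/-- Nondegeneracy makes the differential injective, hence invertible in finite dimension, and the
inverse function theorem applies. -/
theorem SymplecticAt.map_nhds_eq {n : ℕ} {φ : (Fin n → ℂ) → (Fin n → ℂ)} {z : Fin n → ℂ}
    (h : SymplecticAt φ z) : Filter.map φ (nhds z) = nhds (φ z) := by
  have hinj : Function.Injective (fderiv ℝ φ z) := by
    rw [injective_iff_map_eq_zero]
    intro v hv
    refine eq_zero_of_stdSymplecticForm fun w => ?_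
    rw [← h.2 v w, hv]
    simp [stdSymplecticForm]
  let e := (LinearEquiv.ofInjectiveEndo (fderiv ℝ φ z : (Fin n → ℂ) →ₗ[ℝ] (Fin n → ℂ))
    hinj).toContinuousLinearEquiv
  have he : (e : (Fin n → ℂ) →L[ℝ] (Fin n → ℂ)) = fderiv ℝ φ z := by
    ext1 v; rfl
  have hs : HasStrictFDerivAt φ (e : (Fin n → ℂ) →L[ℝ] (Fin n → ℂ)) z := by
    rw [he]; exact h.1.hasStrictFDerivAt (by simp)
  exact hs.map_nhds_eq_of_equiv

/-- An injective local diffeomorphism is an open embedding; this reduces the topological condition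
to injectivity. -/
theorem isSymplecticEmbedding_of_injOn {n : ℕ} {φ : (Fin n → ℂ) → (Fin n → ℂ)}
    {U V : Set (Fin n → ℂ)} (hU : IsOpen U) (hφ : ∀ z ∈ U, SymplecticAt φ z)
    (hinj : U.InjOn φ) (hmaps : U.MapsTo φ V) : IsSymplecticEmbedding φ U V where
  contDiffOn z hz := (hφ z hz).1.contDiffWithinAt
  pullback_eq z hz := (hφ z hz).2
  mapsTo := hmaps
  isEmbedding := by
    have hc : ContinuousOn φ U := fun z hz => (hφ z hz).1.continuousAt.continuousWithinAt
    refine (Topology.IsOpenEmbedding.of_continuous_injective_isOpenMap hc.domRestrict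
      hinj.injective ?_).isEmbedding
    refine IsOpenMap.of_nhds_le fun z => ?_
    have h1 : Filter.map (U.domRestrict φ) (nhds z)
        = Filter.map φ (Filter.map ((↑) : U → _) (nhds z)) := rfl
    rw [h1, hU.isOpenEmbedding_subtypeVal.map_nhds_eq, (hφ z z.2).map_nhds_eq]
    rfl

/-- The line derivatives of a differentiable map compute its differential. -/
theorem fderiv_apply_eq_of_hasDerivAt {E F : Type*} [NormedAddCommGroup E] [NormedSpace ℝ E]
    [NormedAddCommGroup F] [NormedSpace ℝ F] {φ : E → F} {z v : E} {D : F}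
    (hφ : DifferentiableAt ℝ φ z) (h : HasDerivAt (fun t : ℝ => φ (z + t • v)) D 0) :
    fderiv ℝ φ z v = D := by
  rw [← hφ.lineDeriv_eq_fderiv]
  exact HasLineDerivAt.lineDeriv h

theorem isOpen_polydisc {n : ℕ} (a : Fin n → ℝ) : IsOpen (polydisc a) := by
  have : polydisc a = ⋂ i, {z | π * ‖z i‖ ^ 2 < a i} := by
    ext z; simp [polydisc, openDisc]
  rw [this]
  exact isOpen_iInter_of_finite fun i => isOpen_lt (by fun_prop) continuous_const

theorem ContDiffAt.complexMk {E : Type*} [NormedAddCommGroup E] [NormedSpace ℝ E] {a b : E → ℝ}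
    {z : E} {m : WithTop ℕ∞} (ha : ContDiffAt ℝ m a z) (hb : ContDiffAt ℝ m b z) :
    ContDiffAt ℝ m (fun z => (⟨a z, b z⟩ : ℂ)) z :=
  Complex.equivRealProdCLM.symm.contDiff.contDiffAt.comp z (ha.prodMk hb)

theorem HasDerivAt.complexMk {a b : ℝ → ℝ} {a' b' t : ℝ} (ha : HasDerivAt a a' t)
    (hb : HasDerivAt b b' t) : HasDerivAt (fun t => (⟨a t, b t⟩ : ℂ)) ⟨a', b'⟩ t :=
  (Complex.equivRealProdCLM.symm : (ℝ × ℝ) →L[ℝ] ℂ).hasFDerivAt.comp_hasDerivAt t (ha.prodMk hb)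

theorem hasDerivAt_re_line (z v : ℂ) (t : ℝ) :
    HasDerivAt (fun t : ℝ => (z + t • v).re) v.re t := by
  simpa using ((hasDerivAt_id t).mul_const v.re).const_add z.re

theorem hasDerivAt_im_line (z v : ℂ) (t : ℝ) :
    HasDerivAt (fun t : ℝ => (z + t • v).im) v.im t := by
  simpa using ((hasDerivAt_id t).mul_const v.im).const_add z.im

theorem contDiff_re : ContDiff ℝ ∞ Complex.re := Complex.reCLM.contDiff

theorem contDiff_im : ContDiff ℝ ∞ Complex.im := Complex.imCLM.contDiff

/-! ### Area-preserving maps of the plane -/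

/-- The map `(x, y) ↦ (F(y) + x G(y), P(y))` preserves area when `G P' = 1`. -/
theorem areaPreservingAt_graph {F G P : ℝ → ℝ} {z : ℂ} (hF : ContDiffAt ℝ ∞ F z.im)
    (hG : ContDiffAt ℝ ∞ G z.im) (hP : ContDiffAt ℝ ∞ P z.im) (h : G z.im * deriv P z.im = 1) :
    AreaPreservingAt (fun z => ⟨F z.im + z.re * G z.im, P z.im⟩) z := by
  have hs : ContDiffAt ℝ ∞ (fun z : ℂ => (⟨F z.im + z.re * G z.im, P z.im⟩ : ℂ)) z := by
    refine ContDiffAt.complexMk ((hF.comp z contDiff_im.contDiffAt).add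
      (contDiff_re.contDiffAt.mul (hG.comp z contDiff_im.contDiffAt)))
      (hP.comp z contDiff_im.contDiffAt)
  have hd : ∀ v : ℂ, fderiv ℝ (fun z : ℂ => (⟨F z.im + z.re * G z.im, P z.im⟩ : ℂ)) z v
      = ⟨deriv F z.im * v.im + (v.re * G z.im + z.re * (deriv G z.im * v.im)),
        deriv P z.im * v.im⟩ := by
    intro v
    refine fderiv_apply_eq_of_hasDerivAt (hs.differentiableAt (by simp)) ?_
    have him := hasDerivAt_im_line z v 0
    have hre := hasDerivAt_re_line z v 0
    have e0 : (z + (0 : ℝ) • v).im = z.im := by simp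
    have e1 : (z + (0 : ℝ) • v).re = z.re := by simp
    have lift : ∀ {f : ℝ → ℝ}, ContDiffAt ℝ ∞ f z.im →
        HasDerivAt (fun t : ℝ => f (z + t • v).im) (deriv f z.im * v.im) 0 := by
      intro f hf
      have := (hf.differentiableAt (by simp)).hasDerivAt
      rw [← e0] at this
      have := this.comp (0 : ℝ) him
      rw [e0] at this
      exact this
    have := ((lift hF).add (hre.mul (lift hG))).complexMk (lift hP)
    rw [e0, e1] at this
    exact this
  refine ⟨hs, fun v w => ?_⟩
  rw [hd, hd]
  dsimp only
  linear_combination (v.re * w.im - v.im * w.re) * h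

/-- The quarter turn `(x, y) ↦ (y + a, b - x)` preserves area. -/
theorem areaPreservingAt_quarterTurn (a b : ℝ) (z : ℂ) :
    AreaPreservingAt (fun z => ⟨z.im + a, b - z.re⟩) z := by
  have hs : ContDiffAt ℝ ∞ (fun z : ℂ => (⟨z.im + a, b - z.re⟩ : ℂ)) z :=
    ((contDiff_im.add contDiff_const).contDiffAt).complexMk
      ((contDiff_const.sub contDiff_re).contDiffAt)
  have hd : ∀ v : ℂ, fderiv ℝ (fun z : ℂ => (⟨z.im + a, b - z.re⟩ : ℂ)) z v
      = ⟨v.im, -v.re⟩ := by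
    intro v
    refine fderiv_apply_eq_of_hasDerivAt (hs.differentiableAt (by simp)) ?_
    exact ((hasDerivAt_im_line z v 0).add_const a).complexMk
      ((hasDerivAt_re_line z v 0).const_sub b)
  refine ⟨hs, fun v w => ?_⟩
  rw [hd, hd]
  ring

/-- Action-angle coordinates: `(x, y) ↦ √(x/π) e^{2πiy}`. -/
noncomputable def actionAngle (z : ℂ) : ℂ :=
  ⟨√(z.re / π) * Real.cos (2 * π * z.im), √(z.re / π) * Real.sin (2 * π * z.im)⟩

theorem areaPreservingAt_actionAngle {z : ℂ} (hz : 0 < z.re) : AreaPreservingAt actionAngle z := by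
  have hpos : 0 < z.re / π := div_pos hz Real.pi_pos
  have hsq : ContDiffAt ℝ ∞ (fun z : ℂ => √(z.re / π)) z :=
    (contDiff_re.div_const π).contDiffAt.sqrt hpos.ne'
  have hang : ContDiff ℝ ∞ (fun z : ℂ => 2 * π * z.im) := contDiff_const.mul contDiff_im
  have hs : ContDiffAt ℝ ∞ actionAngle z :=
    (hsq.mul (Real.contDiff_cos.comp hang).contDiffAt).complexMk
      (hsq.mul (Real.contDiff_sin.comp hang).contDiffAt)
  have hd : ∀ v : ℂ, fderiv ℝ actionAngle z v
      = ⟨v.re / π / (2 * √(z.re / π)) * Real.cos (2 * π * z.im)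
          + √(z.re / π) * (-Real.sin (2 * π * z.im) * (2 * π * v.im)),
        v.re / π / (2 * √(z.re / π)) * Real.sin (2 * π * z.im)
          + √(z.re / π) * (Real.cos (2 * π * z.im) * (2 * π * v.im))⟩ := by
    intro v
    refine fderiv_apply_eq_of_hasDerivAt (hs.differentiableAt (by simp)) ?_
    have e0 : (z + (0 : ℝ) • v).im = z.im := by simp
    have e1 : (z + (0 : ℝ) • v).re = z.re := by simp
    have h1 := ((hasDerivAt_re_line z v 0).div_const π).sqrt (by rw [e1]; exact hpos.ne')
    have h2 := (hasDerivAt_im_line z v 0).const_mul (2 * π)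
    have := (h1.mul h2.cos).complexMk (h1.mul h2.sin)
    rw [e0, e1] at this
    exact this
  refine ⟨hs, fun v w => ?_⟩
  rw [hd, hd]
  dsimp only
  have hr : √(z.re / π) ≠ 0 := (Real.sqrt_pos.2 hpos).ne'
  have hcs := Real.sin_sq_add_cos_sq (2 * π * z.im)
  generalize √(z.re / π) = r at hr ⊢
  generalize Real.cos (2 * π * z.im) = c at hcs ⊢
  generalize Real.sin (2 * π * z.im) = s at hcs ⊢
  field_simp
  linear_combination 4 * π ^ 2 * r ^ 2 * (v.re * w.im - v.im * w.re) * hcs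

theorem pi_mul_norm_actionAngle_sq {z : ℂ} (hz : 0 ≤ z.re) :
    π * ‖actionAngle z‖ ^ 2 = z.re := by
  rw [← Complex.normSq_eq_norm_sq, Complex.normSq_apply]
  have h1 : √(z.re / π) ^ 2 = z.re / π := Real.sq_sqrt (div_nonneg hz Real.pi_pos.le)
  have hcs := Real.sin_sq_add_cos_sq (2 * π * z.im)
  have : π * (z.re / π) = z.re := by field_simp
  simp only [actionAngle]
  linear_combination π * √(z.re / π) ^ 2 * hcs + π * h1 + this

theorem actionAngle_eq_iff {z z' : ℂ} (hz : 0 < z.re) (hz' : 0 < z'.re)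
    (h : actionAngle z = actionAngle z') : z.re = z'.re ∧ ∃ m : ℤ, z.im = z'.im + m := by
  have hre : z.re = z'.re := by
    rw [← pi_mul_norm_actionAngle_sq hz.le, h, pi_mul_norm_actionAngle_sq hz'.le]
  refine ⟨hre, ?_⟩
  have hr : √(z'.re / π) ≠ 0 := (Real.sqrt_pos.2 (div_pos hz' Real.pi_pos)).ne'
  have h1 := congrArg Complex.re h
  have h2 := congrArg Complex.im h
  simp only [actionAngle, hre] at h1 h2
  have h1 := mul_left_cancel₀ hr h1
  have h2 := mul_left_cancel₀ hr h2
  have h3 : ((2 * π * z.im : ℝ) : Real.Angle) = ((2 * π * z'.im : ℝ) : Real.Angle) :=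
    Real.Angle.cos_sin_inj h1 h2
  rw [Real.Angle.angle_eq_iff_two_pi_dvd_sub] at h3
  obtain ⟨m, hm⟩ := h3
  refine ⟨m, ?_⟩
  have : 2 * π * (z.im - z'.im - m) = 0 := by linear_combination hm
  have := (mul_eq_zero.1 this).resolve_left (by positivity)
  linarith

/-! ### Mapping a disc into the region between two graphs -/

/-- The area of the part below height `y` of the disc of radius `R`, up to a constant: an
antiderivative of the width `2 √(R² - y²)` of the disc at height `y`. -/
noncomputable def discArea (R y : ℝ) : ℝ := y * √(R ^ 2 - y ^ 2) + R ^ 2 * Real.arcsin (y / R)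

theorem hasDerivAt_discArea {R y : ℝ} (hR : 0 < R) (hy : |y| < R) :
    HasDerivAt (discArea R) (2 * √(R ^ 2 - y ^ 2)) y := by
  have hlt := abs_lt.1 hy
  have hpos : 0 < R ^ 2 - y ^ 2 := by nlinarith
  have h1 : HasDerivAt (fun y : ℝ => √(R ^ 2 - y ^ 2))
      (-(2 * y) / (2 * √(R ^ 2 - y ^ 2))) y := by
    have : HasDerivAt (fun y : ℝ => R ^ 2 - y ^ 2) (-(2 * y)) y := by
      simpa using (hasDerivAt_pow 2 y).const_sub (R ^ 2)
    exact this.sqrt hpos.ne'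
  have hm1 : -1 < y / R := by rw [lt_div_iff₀ hR]; linarith
  have hl1 : y / R < 1 := by rw [div_lt_iff₀ hR]; linarith
  have h2 := (Real.hasDerivAt_arcsin hm1.ne' hl1.ne).comp y ((hasDerivAt_id y).div_const R)
  have h3 := ((hasDerivAt_id y).mul h1).add (h2.const_mul (R ^ 2))
  have hsq : √(1 - (y / R) ^ 2) = √(R ^ 2 - y ^ 2) / R := by
    rw [show 1 - (y / R) ^ 2 = (R ^ 2 - y ^ 2) / R ^ 2 by field_simp, Real.sqrt_div hpos.le,
      Real.sqrt_sq hR.le]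
  have hs : √(R ^ 2 - y ^ 2) ≠ 0 := (Real.sqrt_pos.2 hpos).ne'
  have hss : √(R ^ 2 - y ^ 2) ^ 2 = R ^ 2 - y ^ 2 := Real.sq_sqrt hpos.le
  refine h3.congr_deriv ?_
  rw [hsq]
  dsimp only [id]
  field_simp
  linear_combination -hss

theorem contDiffAt_discArea {R y : ℝ} (hR : 0 < R) (hy : |y| < R) :
    ContDiffAt ℝ ∞ (discArea R) y := by
  have hlt := abs_lt.1 hy
  have hpos : 0 < R ^ 2 - y ^ 2 := by nlinarith
  have hm1 : -1 < y / R := by rw [lt_div_iff₀ hR]; linarith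
  have hl1 : y / R < 1 := by rw [div_lt_iff₀ hR]; linarith
  have h1 : ContDiffAt ℝ ∞ (fun y : ℝ => √(R ^ 2 - y ^ 2)) y :=
    (contDiffAt_const.sub (contDiffAt_id.pow 2)).sqrt hpos.ne'
  have h2 : ContDiffAt ℝ ∞ (fun y : ℝ => Real.arcsin (y / R)) y :=
    ContDiffAt.comp (g := Real.arcsin) y (Real.contDiffAt_arcsin hm1.ne' hl1.ne)
      (contDiffAt_id.div_const R)
  exact (contDiffAt_id.mul h1).add (contDiffAt_const.mul h2)

theorem strictMonoOn_discArea {R : ℝ} (hR : 0 < R) :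
    StrictMonoOn (discArea R) (Set.Icc (-R) R) := by
  refine strictMonoOn_of_deriv_pos (convex_Icc _ _) ?_ fun y hy => ?_
  · unfold discArea
    exact Continuous.continuousOn (by fun_prop)
  · rw [interior_Icc] at hy
    rw [(hasDerivAt_discArea hR (abs_lt.2 hy)).deriv]
    have : 0 < R ^ 2 - y ^ 2 := by nlinarith [hy.1, hy.2]
    positivity

theorem abs_discArea_lt {R y : ℝ} (hR : 0 < R) (hy : |y| < R) :
    |discArea R y| < π * R ^ 2 / 2 := by
  have hlt := abs_lt.1 hy
  have h1 := strictMonoOn_discArea hR ⟨hlt.1.le, hlt.2.le⟩ ⟨by linarith, le_rfl⟩ hlt.2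
  have h2 := strictMonoOn_discArea hR ⟨le_rfl, by linarith⟩ ⟨hlt.1.le, hlt.2.le⟩ hlt.1
  have e1 : discArea R R = π * R ^ 2 / 2 := by
    simp [discArea, div_self hR.ne']; ring
  have e2 : discArea R (-R) = -(π * R ^ 2 / 2) := by
    simp [discArea, neg_div, div_self hR.ne']; ring
  rw [e1] at h1
  rw [e2] at h2
  exact abs_lt.2 ⟨h2, h1⟩

theorem im_re_bounds_of_mem_openDisc {R a : ℝ} (hR : 0 < R) (ha : a ≤ π * R ^ 2) {z : ℂ}
    (hz : z ∈ openDisc a) : |z.im| < R ∧ |z.re| < √(R ^ 2 - z.im ^ 2) := by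
  have h1 : π * ‖z‖ ^ 2 < π * R ^ 2 := lt_of_lt_of_le hz ha
  have h2 := lt_of_mul_lt_mul_left h1 Real.pi_pos.le
  rw [← Complex.normSq_eq_norm_sq, Complex.normSq_apply] at h2
  refine ⟨abs_lt_of_sq_lt_sq (by nlinarith) hR.le, ?_⟩
  refine Real.lt_sqrt_of_sq_lt ?_
  rw [sq_abs]
  nlinarith

/-- A smooth positive function `h` has an antiderivative vanishing at `0` whose inverse `P` is
smooth on `(0, S)`, with values in `(0, N)`, if `S ≤ ∫₀ᴺ h`. -/
theorem exists_inverse_antideriv {h : ℝ → ℝ} (hh : ContDiff ℝ ∞ h) (hpos : ∀ x, 0 < h x)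
    {N S : ℝ} (hN : 0 ≤ N) (hS : S ≤ ∫ x in (0 : ℝ)..N, h x) :
    ∃ P : ℝ → ℝ, Set.InjOn P (Set.Ioo 0 S) ∧ ∀ s ∈ Set.Ioo 0 S, 0 < P s ∧ P s < N ∧
      ContDiffAt ℝ ∞ P s ∧ HasDerivAt P (h (P s))⁻¹ s := by
  set H : ℝ → ℝ := fun x => ∫ t in (0 : ℝ)..x, h t with hH
  have hderiv : ∀ x, HasDerivAt H (h x) x := fun x =>
    intervalIntegral.integral_hasDerivAt_right (hh.continuous.intervalIntegrable _ _)
      hh.continuous.stronglyMeasurable.stronglyMeasurableAtFilter hh.continuous.continuousAt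
  have hsm : ContDiff ℝ ∞ H := by
    rw [contDiff_infty_iff_deriv]
    refine ⟨fun x => (hderiv x).differentiableAt, ?_⟩
    rwa [show deriv H = h from funext fun x => (hderiv x).deriv]
  have hmono : StrictMono H := strictMono_of_deriv_pos fun x => by
    rw [(hderiv x).deriv]; exact hpos x
  have hopen : IsOpenMap H := isOpenMap_of_hasStrictDerivAt
    (fun x => (hsm.contDiffAt.hasStrictDerivAt' (hderiv x) (by simp)))
    fun x => (hpos x).ne'
  have hemb : Topology.IsOpenEmbedding H :=
    .of_continuous_injective_isOpenMap hsm.continuous hmono.injective hopen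
  let e := hemb.toOpenPartialHomeomorph H
  have hrange : ∀ s ∈ Set.Ioo 0 S, ∃ x, 0 < x ∧ x < N ∧ H x = s := by
    intro s hs
    have h0 : H 0 = 0 := intervalIntegral.integral_same
    obtain ⟨x, hx, rfl⟩ := intermediate_value_Ioo hN hsm.continuous.continuousOn
      (show s ∈ Set.Ioo (H 0) (H N) from ⟨by rw [h0]; exact hs.1, hs.2.trans_le hS⟩)
    exact ⟨x, hx.1, hx.2, rfl⟩
  have hsymm : ∀ x, e.symm (H x) = x := fun x => e.left_inv (by simp [e])
  refine ⟨e.symm, ?_, ?_⟩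
  · intro s hs s' hs' heq
    obtain ⟨x, -, -, rfl⟩ := hrange s hs
    obtain ⟨x', -, -, rfl⟩ := hrange s' hs'
    rw [hsymm, hsymm] at heq
    rw [heq]
  · intro s hs
    obtain ⟨x, hx0, hxN, rfl⟩ := hrange s hs
    have ht : H x ∈ e.target := e.map_source (by simp [e])
    have hd : HasDerivAt e (h (e.symm (H x))) (e.symm (H x)) := hderiv _
    refine ⟨by rwa [hsymm], by rwa [hsymm], ?_, ?_⟩
    · exact e.contDiffAt_symm_deriv (hpos _).ne' ht hd hsm.contDiffAt
    · exact e.hasDerivAt_symm ht (hpos _).ne' hd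

/-- A disc embeds, area preservingly, in the region `{f(y) < x < f(y) + h(y), 0 < y < N}` of
larger area. -/
theorem exists_areaPreserving_openDisc_graph {f h : ℝ → ℝ} (hf : ContDiff ℝ ∞ f)
    (hh : ContDiff ℝ ∞ h) (hpos : ∀ x, 0 < h x) {N a : ℝ} (hN : 0 ≤ N) (ha : 0 < a)
    (hint : a < ∫ x in (0 : ℝ)..N, h x) :
    ∃ g : ℂ → ℂ, Set.InjOn g (openDisc a) ∧ ∀ z ∈ openDisc a, AreaPreservingAt g z ∧
      0 < (g z).im ∧ (g z).im < N ∧ f (g z).im < (g z).re ∧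
      (g z).re < f (g z).im + h (g z).im := by
  set S := ∫ x in (0 : ℝ)..N, h x with hS
  have hS0 : 0 < S := ha.trans hint
  obtain ⟨P, hPinj, hP⟩ := exists_inverse_antideriv hh hpos hN hS.le
  set R := √(S / π) with hRdef
  have hR : 0 < R := Real.sqrt_pos.2 (div_pos hS0 Real.pi_pos)
  have hSR : π * R ^ 2 = S := by
    rw [hRdef, Real.sq_sqrt (div_pos hS0 Real.pi_pos).le]; field_simp
  have hbd : ∀ z ∈ openDisc a, |z.im| < R ∧ |z.re| < √(R ^ 2 - z.im ^ 2) := fun z hz =>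
    im_re_bounds_of_mem_openDisc hR (by rw [hSR]; exact hint.le) hz
  have hW : ∀ y, |y| < R → discArea R y + S / 2 ∈ Set.Ioo 0 S := by
    intro y hy
    have := abs_lt.1 (abs_discArea_lt hR hy)
    rw [hSR] at this
    constructor <;> linarith [this.1, this.2]
  let p : ℝ → ℝ := fun y => P (discArea R y + S / 2)
  have hpsm : ∀ y, |y| < R → ContDiffAt ℝ ∞ p y := fun y hy =>
    ContDiffAt.comp (g := P) (f := fun y => discArea R y + S / 2) y (hP _ (hW y hy)).2.2.1
      ((contDiffAt_discArea hR hy).add contDiffAt_const)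
  have hpd : ∀ y, |y| < R → HasDerivAt p ((h (p y))⁻¹ * (2 * √(R ^ 2 - y ^ 2))) y := fun y hy =>
    HasDerivAt.comp (h₂ := P) (h := fun y => discArea R y + S / 2) y (hP _ (hW y hy)).2.2.2
      ((hasDerivAt_discArea hR hy).add_const (S / 2))
  -- The height `p(y)` is chosen so that the region below it has the same area as the part of the
  -- disc of area `S` below `y`. Each horizontal slice of that disc is then stretched affinely onto
  -- the slice of the region. The disc of area `a < S` stays off the boundary, where smoothness
  -- fails.
  refine ⟨fun z => ⟨(f (p z.im) + h (p z.im) / 2)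
    + z.re * (h (p z.im) / (2 * √(R ^ 2 - z.im ^ 2))), p z.im⟩, ?_, ?_⟩
  · intro z hz z' hz' heq
    obtain ⟨hy, hx⟩ := hbd z hz
    obtain ⟨hy', hx'⟩ := hbd z' hz'
    have him : z.im = z'.im := by
      have h1 : P (discArea R z.im + S / 2) = P (discArea R z'.im + S / 2) :=
        congrArg Complex.im heq
      have h2 := hPinj (hW _ hy) (hW _ hy') h1
      have h3 := abs_lt.1 hy
      have h4 := abs_lt.1 hy'
      exact (strictMonoOn_discArea hR).injOn ⟨h3.1.le, h3.2.le⟩ ⟨h4.1.le, h4.2.le⟩ (by linarith)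
    have hre := congrArg Complex.re heq
    dsimp only at hre
    rw [← him] at hre
    have hne : h (p z.im) / (2 * √(R ^ 2 - z.im ^ 2)) ≠ 0 :=
      (div_pos (hpos _) (mul_pos two_pos ((abs_nonneg _).trans_lt hx))).ne'
    exact Complex.ext (mul_right_cancel₀ hne (add_left_cancel hre)) him
  · intro z hz
    obtain ⟨hy, hx⟩ := hbd z hz
    have hs : 0 < √(R ^ 2 - z.im ^ 2) := (abs_nonneg _).trans_lt hx
    have hs' : 0 < R ^ 2 - z.im ^ 2 := Real.sqrt_pos.1 hs
    have hp0 : 0 < h (p z.im) := hpos _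
    refine ⟨?_, (hP _ (hW _ hy)).1, (hP _ (hW _ hy)).2.1, ?_⟩
    · refine areaPreservingAt_graph (F := fun y => f (p y) + h (p y) / 2)
        (G := fun y => h (p y) / (2 * √(R ^ 2 - y ^ 2))) (P := p) ?_ ?_ (hpsm _ hy) ?_
      · exact (hf.contDiffAt.comp z.im (hpsm _ hy)).add
          ((hh.contDiffAt.comp z.im (hpsm _ hy)).div_const 2)
      · refine (hh.contDiffAt.comp z.im (hpsm _ hy)).div (contDiffAt_const.mul
          (ContDiffAt.sqrt (contDiffAt_const.sub (contDiffAt_id.pow 2)) hs'.ne')) ?_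
        exact (mul_pos two_pos hs).ne'
      · rw [(hpd _ hy).deriv]
        field_simp
    · dsimp only
      set r := √(R ^ 2 - z.im ^ 2)
      have hx := abs_lt.1 hx
      have e : z.re * (h (p z.im) / (2 * r)) = h (p z.im) * (z.re / r) / 2 := by
        field_simp
      have h1 : -1 < z.re / r := by rw [lt_div_iff₀ hs]; linarith [hx.1]
      have h2 : z.re / r < 1 := by rw [div_lt_iff₀ hs]; linarith [hx.2]
      rw [e]
      constructor <;> nlinarith

theorem exists_areaPreserving_openDisc_rectangle {a w : ℝ} (ha : 0 < a) (haw : a < w) :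
    ∃ g : ℂ → ℂ, Set.InjOn g (openDisc a) ∧ ∀ z ∈ openDisc a, AreaPreservingAt g z ∧
      0 < (g z).re ∧ (g z).re < w ∧ 0 < (g z).im ∧ (g z).im < 1 := by
  obtain ⟨g, hinj, hg⟩ := exists_areaPreserving_openDisc_graph (f := fun _ => 0) (h := fun _ => 1)
    contDiff_const contDiff_const (fun _ => one_pos) (ha.trans haw).le ha (by simpa using haw)
  -- The graph construction gives a rectangle of width `1` and height `w`; a quarter turn exchanges
  -- the sides.
  refine ⟨(fun z => ⟨z.im + 0, 1 - z.re⟩) ∘ g, ?_, fun z hz => ?_⟩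
  · intro z hz z' hz' heq
    have h1 := congrArg Complex.re heq
    have h2 := congrArg Complex.im heq
    simp only [Function.comp_apply] at h1 h2
    exact hinj hz hz' (Complex.ext (by linarith) (by linarith))
  · obtain ⟨h0, h1, h2, h3, h4⟩ := hg z hz
    refine ⟨(areaPreservingAt_quarterTurn 0 1 (g z)).comp h0, ?_, ?_, ?_, ?_⟩ <;>
      simp only [Function.comp_apply] <;> linarith

/-! ### Smooth steps and smooth solutions of convex conditions -/

/-- A smooth nondecreasing function rising from `0` to `w` with slope at most `μ`. -/
theorem exists_smooth_step {w d μ : ℝ} (hw : 0 < w) (hd : 0 < d) (hμ : 0 < μ) :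
    ∃ c : ℝ → ℝ, ContDiff ℝ ∞ c ∧ (∀ s ≤ d, c s = 0) ∧ (∀ s, 4 * d + w / μ ≤ s → c s = w) ∧
      ∀ s, 0 ≤ deriv c s ∧ deriv c s ≤ μ := by
  have hwμ : 0 < w / μ := div_pos hw hμ
  -- The inner interval has length `w / μ`, so the normalised bump is at most `μ / w`; its support
  -- is `(d, 3d + w/μ)`.
  let b : ContDiffBump (2 * d + w / μ / 2) :=
    ⟨w / μ / 2, d + w / μ / 2, by linarith, by linarith⟩
  let g : ℝ → ℝ := fun s => w * b.normed MeasureTheory.volume s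
  have hgsm : ContDiff ℝ ∞ g := contDiff_const.mul b.contDiff_normed
  have hcont := hgsm.continuous
  have hsupp : Function.support (b.normed MeasureTheory.volume)
      = Set.Ioo d (3 * d + w / μ) := by
    rw [b.support_normed_eq, Real.ball_eq_Ioo]
    congr 1 <;> simp only [b] <;> ring
  have hderiv : ∀ s, HasDerivAt (fun s => ∫ t in (0 : ℝ)..s, g t) (g s) s := fun s =>
    intervalIntegral.integral_hasDerivAt_right (hcont.intervalIntegrable _ _)
      hcont.stronglyMeasurable.stronglyMeasurableAtFilter hcont.continuousAt
  have hderiv' : deriv (fun s => ∫ t in (0 : ℝ)..s, g t) = g := funext fun s => (hderiv s).deriv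
  refine ⟨fun s => ∫ t in (0 : ℝ)..s, g t, ?_, ?_, ?_, ?_⟩
  · rw [contDiff_infty_iff_deriv, hderiv']
    exact ⟨fun s => (hderiv s).differentiableAt, hgsm⟩
  · intro s hs
    refine intervalIntegral.integral_zero_ae (Filter.Eventually.of_forall fun t ht => ?_)
    have ht' : t ≤ d := ht.2.trans (max_le hd.le hs)
    have : t ∉ Function.support (b.normed MeasureTheory.volume) := by
      rw [hsupp]; exact fun h => absurd h.1 (not_lt.2 ht')
    simp only [g, Function.notMem_support.1 this, mul_zero]
  · intro s hs
    simp only [g, intervalIntegral.integral_const_mul]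
    rw [intervalIntegral.integral_eq_integral_of_support_subset, b.integral_normed, mul_one]
    rw [hsupp]
    exact fun t ht => ⟨by linarith [ht.1], by linarith [ht.2]⟩
  · intro s
    rw [hderiv']
    refine ⟨mul_nonneg hw.le (b.nonneg_normed s), ?_⟩
    have h1 := b.normed_le_div_measure_closedBall_rIn MeasureTheory.volume s
    have h2 : MeasureTheory.volume.real (Metric.closedBall (2 * d + w / μ / 2) b.rIn) = w / μ := by
      rw [Real.volume_real_closedBall (by simp only [b]; positivity)]
      simp only [b]; ring
    rw [h2] at h1
    calc g s ≤ w * (1 / (w / μ)) := mul_le_mul_of_nonneg_left h1 hw.le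
      _ = μ := by field_simp

/-- Finitely many convex conditions, each imposed over a closed set, have a smooth solution
if they have a solution at each point. -/
theorem exists_contDiff_forall_mem_convex {ι F : Type*} [Finite ι] [NormedAddCommGroup F]
    [NormedSpace ℝ F] {K : ι → Set ℝ} {T : ι → Set F} (hK : ∀ i, IsClosed (K i))
    (hT : ∀ i, Convex ℝ (T i)) (hne : ∀ x, ∃ y, ∀ i, x ∈ K i → y ∈ T i) :
    ∃ g : ℝ → F, ContDiff ℝ ∞ g ∧ ∀ x i, x ∈ K i → g x ∈ T i := by
  obtain ⟨g, hg⟩ := exists_contMDiffMap_forall_mem_convex_of_local_const (n := ⊤)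
    (modelWithCornersSelf ℝ ℝ)
    (t := fun x => {y : F | ∀ i, x ∈ K i → y ∈ T i})
    (fun x y hy z hz a b ha hb hab i hi => hT i (hy i hi) (hz i hi) ha hb hab)
    (fun x => by
      obtain ⟨y, hy⟩ := hne x
      refine ⟨y, ?_⟩
      -- By closedness no condition inactive at `x` becomes active nearby, so the solution `y` at
      -- `x` works locally as a constant.
      have : ∀ᶠ x' in nhds x, ∀ i, x' ∈ K i → x ∈ K i := by
        refine Filter.eventually_all.2 fun i => ?_
        by_cases hx : x ∈ K i
        · exact Filter.Eventually.of_forall fun _ _ => hx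
        · filter_upwards [(hK i).isOpen_compl.mem_nhds hx] with x' h1 h2
          exact absurd h2 h1
      filter_upwards [this] with x' hx' i hi
      exact hy i (hx' i hi))
  exact ⟨g, g.contMDiff.contDiff, fun x i => hg x i⟩

theorem Nat.le_of_cast_lt_add_one {i j : ℕ} (h : (i : ℝ) < j + 1) : i ≤ j :=
  Nat.lt_succ_iff.1 (by exact_mod_cast h)

/-! ### The comb: chambers joined by gates -/

/-- Bounds on the vertical extent of a row of `n` rectangles over the intervals `[j, j + 1]`, in
which neighbours communicate through narrow gates over the integers: `bot j` and `top j` bound the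
`j`-th rectangle, `gateLo j` and `gateHi j` the gate at `j`, and `lo j`, `hi j` the part near it. -/
structure CombBounds where
  bot : ℕ → ℝ
  top : ℕ → ℝ
  lo : ℕ → ℝ
  hi : ℕ → ℝ
  gateLo : ℕ → ℝ
  gateHi : ℕ → ℝ

/-- The fibre `{f < q < f + h}` over `p` respects the bounds `B`, with a margin `d`, and almost
exhausts them in the middle of each rectangle. -/
structure IsComb (B : CombBounds) (n : ℕ) (d p f h : ℝ) : Prop where
  f_pos : 0 < f
  h_pos : 0 < h
  gate : ∀ j < n, 1 ≤ j → (j : ℝ) ≤ p → p ≤ j → B.gateLo j < f ∧ f + h < B.gateHi j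
  near : ∀ j ≤ n, (j : ℝ) - d ≤ p → p ≤ j + d → B.lo j < f ∧ f + h < B.hi j
  middle : ∀ j < n, (j : ℝ) + d ≤ p → p ≤ j + 1 - d → B.bot j < f ∧ f + h < B.top j
  height : ∀ j < n, (j : ℝ) + 2 * d ≤ p → p ≤ j + 1 - 2 * d → B.top j - B.bot j - d < h

/-- The bounds `B` are compatible: all rectangles and all parts near gates have the interval
`[l, m]` in common. -/
structure CombBounds.Compatible (B : CombBounds) (n : ℕ) (l m : ℝ) : Prop where
  nonneg : 0 ≤ l
  lt : l < m
  lo : ∀ j ≤ n, 0 ≤ B.lo j ∧ B.lo j ≤ l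
  hi : ∀ j ≤ n, m ≤ B.hi j
  bot : ∀ j < n, 0 ≤ B.bot j ∧ B.bot j ≤ l
  top : ∀ j < n, m ≤ B.top j
  gate : ∀ j < n, 1 ≤ j → B.lo j ≤ B.gateLo j ∧ B.gateLo j < B.gateHi j ∧ B.gateHi j ≤ B.hi j

/-- Since `5d < 1`, gates and deep middles of chambers are never active together. At a gate the
fibre is shrunk into the gate, in a deep middle it nearly fills the chamber, and elsewhere a fibre
inside the common interval `[l, m]` meets every remaining condition. -/
theorem exists_isComb {B : CombBounds} {n : ℕ} {l m d : ℝ} (hB : B.Compatible n l m) (hd : 0 < d)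
    (hd5 : 5 * d < 1) (p : ℝ) : ∃ y : ℝ × ℝ, IsComb B n d p y.1 y.2 := by
  have hlm := hB.lt
  have hl := hB.nonneg
  by_cases hA : ∃ j < n, 1 ≤ j ∧ (j : ℝ) = p
  · obtain ⟨j, hj, hj1, rfl⟩ := hA
    obtain ⟨g1, g2, g3⟩ := hB.gate j hj hj1
    have g0 := (hB.lo j hj.le).1
    refine ⟨(B.gateLo j + (B.gateHi j - B.gateLo j) / 4, (B.gateHi j - B.gateLo j) / 4),
      ?_, ?_, ?_, ?_, ?_, ?_⟩ <;> dsimp only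
    · linarith
    · linarith
    · intro i hi _ h3 h4
      have e : i = j := by exact_mod_cast le_antisymm h3 h4
      subst e
      constructor <;> linarith
    · intro i hi h3 h4
      have e : i = j := le_antisymm (Nat.le_of_cast_lt_add_one (by linarith))
        (Nat.le_of_cast_lt_add_one (by linarith))
      subst e
      constructor <;> linarith
    · intro i hi h3 h4
      have e : i = j := le_antisymm (Nat.le_of_cast_lt_add_one (by linarith))
        (Nat.le_of_cast_lt_add_one (by linarith))
      subst e; linarith
    · intro i hi h3 h4
      have e : i = j := le_antisymm (Nat.le_of_cast_lt_add_one (by linarith))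
        (Nat.le_of_cast_lt_add_one (by linarith))
      subst e; linarith
  · have hno : ∀ i < n, 1 ≤ i → (i : ℝ) ≤ p → p ≤ i → False :=
      fun i hi h1 h2 h3 => hA ⟨i, hi, h1, le_antisymm h2 h3⟩
    by_cases hC : ∃ j < n, (j : ℝ) + 2 * d ≤ p ∧ p ≤ j + 1 - 2 * d
    · obtain ⟨j, hj, h1, h2⟩ := hC
      have hb := hB.bot j hj
      have ht := hB.top j hj
      obtain ⟨e, he0, hed, hem⟩ : ∃ e : ℝ, 0 < e ∧ 4 * e ≤ d ∧ 4 * e ≤ m - l :=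
        ⟨min d (m - l) / 4, by have := lt_min hd (sub_pos.2 hlm); positivity,
          by linarith [min_le_left d (m - l)], by linarith [min_le_right d (m - l)]⟩
      refine ⟨(B.bot j + e, B.top j - B.bot j - 2 * e), ?_, ?_, ?_, ?_, ?_, ?_⟩ <;> dsimp only
      · linarith
      · linarith
      · intro i hi h5 h3 h4
        exact (hno i hi h5 h3 h4).elim
      · intro i hi h3 h4
        have e1 : i ≤ j := Nat.le_of_cast_lt_add_one (by linarith)
        have e2 : j + 1 ≤ i := by
          have : (j : ℝ) < i := by linarith
          exact_mod_cast this
        omega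
      · intro i hi h3 h4
        have e : i = j := le_antisymm (Nat.le_of_cast_lt_add_one (by linarith))
          (Nat.le_of_cast_lt_add_one (by linarith))
        subst e
        constructor <;> linarith
      · intro i hi h3 h4
        have e : i = j := le_antisymm (Nat.le_of_cast_lt_add_one (by linarith))
          (Nat.le_of_cast_lt_add_one (by linarith))
        subst e; linarith
    · refine ⟨(l + (m - l) / 4, (m - l) / 4), ?_, ?_, ?_, ?_, ?_, ?_⟩ <;> dsimp only
      · linarith
      · linarith
      · intro i hi h5 h3 h4
        exact (hno i hi h5 h3 h4).elim
      · intro i hi _ _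
        have := hB.lo i hi
        have := hB.hi i hi
        constructor <;> linarith
      · intro i hi _ _
        have := hB.bot i hi
        have := hB.top i hi
        constructor <;> linarith
      · intro i hi h3 h4
        exact (hC ⟨i, hi, h3, h4⟩).elim

/-- All conditions of `IsComb` are convex in `(f, h)` and imposed over closed sets of `p`, so
pointwise solutions can be patched by a partition of unity. -/
theorem exists_contDiff_isComb {B : CombBounds} {n : ℕ} {l m d : ℝ} (hB : B.Compatible n l m)
    (hd : 0 < d) (hd5 : 5 * d < 1) :
    ∃ f h : ℝ → ℝ, ContDiff ℝ ∞ f ∧ ContDiff ℝ ∞ h ∧ ∀ p, IsComb B n d p (f p) (h p) := by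
  -- `none` carries positivity, imposed for all `p`; the restrictions on `j` enter as factors that
  -- are empty or everything.
  let K : Option (Fin (n + 1) × Fin 4) → Set ℝ := fun i => i.elim Set.univ fun i =>
    (![{p | i.1.1 < n ∧ 1 ≤ i.1.1} ∩ Set.Icc (i.1.1 : ℝ) i.1.1, Set.Icc ((i.1.1 : ℝ) - d) (i.1.1 + d),
      {p | i.1.1 < n} ∩ Set.Icc ((i.1.1 : ℝ) + d) (i.1.1 + 1 - d),
      {p | i.1.1 < n} ∩ Set.Icc ((i.1.1 : ℝ) + 2 * d) (i.1.1 + 1 - 2 * d)] : Fin 4 → Set ℝ) i.2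
  let T : Option (Fin (n + 1) × Fin 4) → Set (ℝ × ℝ) := fun i =>
    i.elim {y | 0 < y.1 ∧ 0 < y.2} fun i =>
    (![{y | B.gateLo i.1 < y.1 ∧ y.1 + y.2 < B.gateHi i.1},
      {y | B.lo i.1 < y.1 ∧ y.1 + y.2 < B.hi i.1},
      {y | B.bot i.1 < y.1 ∧ y.1 + y.2 < B.top i.1},
      {y | B.top i.1 - B.bot i.1 - d < y.2}] : Fin 4 → Set (ℝ × ℝ)) i.2
  have iff : ∀ (p : ℝ) (y : ℝ × ℝ), (∀ i, p ∈ K i → y ∈ T i) ↔ IsComb B n d p y.1 y.2 := by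
    intro p y
    constructor
    · intro H
      refine ⟨(H none trivial).1, (H none trivial).2, fun j hj h0 h1 h2 => ?_,
        fun j hj h1 h2 => ?_, fun j hj h1 h2 => ?_, fun j hj h1 h2 => ?_⟩
      · exact H (some (⟨j, by omega⟩, 0)) ⟨⟨hj, h0⟩, h1, h2⟩
      · exact H (some (⟨j, by omega⟩, 1)) ⟨h1, h2⟩
      · exact H (some (⟨j, by omega⟩, 2)) ⟨hj, h1, h2⟩
      · exact H (some (⟨j, by omega⟩, 3)) ⟨hj, h1, h2⟩
    · rintro H (_ | ⟨⟨j, hj⟩, i⟩)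
      · exact fun _ => ⟨H.f_pos, H.h_pos⟩
      · fin_cases i
        · exact fun h => H.gate j h.1.1 h.1.2 h.2.1 h.2.2
        · exact fun h => H.near j (by omega) h.1 h.2
        · exact fun h => H.middle j h.1 h.2.1 h.2.2
        · exact fun h => H.height j h.1 h.2.1 h.2.2
  have hadd : IsLinearMap ℝ fun y : ℝ × ℝ => y.1 + y.2 :=
    (LinearMap.fst ℝ ℝ ℝ + LinearMap.snd ℝ ℝ ℝ).isLinear
  have hfst : IsLinearMap ℝ fun y : ℝ × ℝ => y.1 := (LinearMap.fst ℝ ℝ ℝ).isLinear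
  have hsnd : IsLinearMap ℝ fun y : ℝ × ℝ => y.2 := (LinearMap.snd ℝ ℝ ℝ).isLinear
  obtain ⟨g, hg, hgK⟩ := exists_contDiff_forall_mem_convex (K := K) (T := T)
    (by
      rintro (_ | ⟨j, i⟩)
      · exact isClosed_univ
      · fin_cases i
        · exact isClosed_const.inter isClosed_Icc
        · exact isClosed_Icc
        all_goals exact isClosed_const.inter isClosed_Icc)
    (by
      rintro (_ | ⟨j, i⟩)
      · exact (convex_halfSpace_gt hfst 0).inter (convex_halfSpace_gt hsnd 0)
      · fin_cases i
        · exact (convex_halfSpace_gt hfst _).inter (convex_halfSpace_lt hadd _)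
        · exact (convex_halfSpace_gt hfst _).inter (convex_halfSpace_lt hadd _)
        · exact (convex_halfSpace_gt hfst _).inter (convex_halfSpace_lt hadd _)
        · exact convex_halfSpace_gt hsnd _)
    (fun p => by
      obtain ⟨y, hy⟩ := exists_isComb hB hd hd5 p
      exact ⟨y, (iff p y).2 hy⟩)
  exact ⟨fun p => (g p).1, fun p => (g p).2, hg.fst, hg.snd, fun p => (iff p (g p)).1 (hgK p)⟩

/-- Only the deep middle of each chamber, of length `1 - 4d`, is counted; elsewhere `h > 0`
suffices. -/
theorem le_integral_of_isComb {B : CombBounds} {n : ℕ} {d : ℝ} {f h : ℝ → ℝ} (hd : 0 < d)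
    (hd5 : 5 * d < 1) (hh : Continuous h) (H : ∀ p, IsComb B n d p (f p) (h p)) :
    ∑ j ∈ Finset.range n, (1 - 4 * d) * (B.top j - B.bot j - d) ≤ ∫ p in (0 : ℝ)..n, h p := by
  have hI : ∀ a b : ℝ, IntervalIntegrable h MeasureTheory.volume a b :=
    fun a b => hh.intervalIntegrable a b
  have h1 := intervalIntegral.sum_integral_adjacent_intervals (f := h)
    (μ := MeasureTheory.volume) (a := fun j : ℕ => (j : ℝ)) (n := n) fun k _ => hI _ _
  rw [Nat.cast_zero] at h1
  rw [← h1]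
  refine Finset.sum_le_sum fun j hj => ?_
  have hle : (j : ℝ) + 2 * d ≤ j + 1 - 2 * d := by linarith
  calc (1 - 4 * d) * (B.top j - B.bot j - d)
      = ∫ p in (j + 2 * d : ℝ)..(j + 1 - 2 * d), (B.top j - B.bot j - d) := by
        rw [intervalIntegral.integral_const, smul_eq_mul]; ring
    _ ≤ ∫ p in (j + 2 * d : ℝ)..(j + 1 - 2 * d), h p := by
        refine intervalIntegral.integral_mono_on hle (by simp) (hI _ _) fun p hp => ?_
        exact ((H p).height j (Finset.mem_range.1 hj) hp.1 hp.2).le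
    _ ≤ ∫ p in (j : ℝ)..((j + 1 : ℕ) : ℝ), h p := by
        refine intervalIntegral.integral_mono_interval (by linarith) hle (by push_cast; linarith)
          (Filter.Eventually.of_forall fun p => (H p).h_pos.le) (hI _ _)

/-! ### The lifting shear and the data of the folding -/

/-- The map `(u, v, q, p) ↦ (u + b + r(q), v, q, p - r'(q) (v - v₀))` is symplectic, where
`z₀ = u + iv` and `z₁ = q + ip`. -/
theorem symplecticAt_lift {r : ℝ → ℝ} (hr : ContDiff ℝ ∞ r) (b v₀ : ℝ) (z : Fin 2 → ℂ) :
    SymplecticAt (fun z : Fin 2 → ℂ => ![⟨(z 0).re + (b + r (z 1).re), (z 0).im⟩,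
      ⟨(z 1).re, (z 1).im - deriv r (z 1).re * ((z 0).im - v₀)⟩]) z := by
  have hr' : ContDiff ℝ ∞ (deriv r) := (contDiff_infty_iff_deriv.1 hr).2
  have hcoord : ∀ i, ContDiff ℝ ∞ (fun z : Fin 2 → ℂ => z i) := fun i => contDiff_apply ℝ ℂ i
  have hre : ∀ i, ContDiff ℝ ∞ (fun z : Fin 2 → ℂ => (z i).re) := fun i =>
    contDiff_re.comp (hcoord i)
  have him : ∀ i, ContDiff ℝ ∞ (fun z : Fin 2 → ℂ => (z i).im) := fun i =>
    contDiff_im.comp (hcoord i)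
  have hs : ContDiffAt ℝ ∞ (fun z : Fin 2 → ℂ => ![(⟨(z 0).re + (b + r (z 1).re), (z 0).im⟩ : ℂ),
      ⟨(z 1).re, (z 1).im - deriv r (z 1).re * ((z 0).im - v₀)⟩]) z := by
    refine contDiffAt_pi.2 fun i => ?_
    fin_cases i
    · exact (((hre 0).add (contDiff_const.add (hr.comp (hre 1)))).contDiffAt).complexMk
        (him 0).contDiffAt
    · exact (hre 1).contDiffAt.complexMk
        ((him 1).sub ((hr'.comp (hre 1)).mul ((him 0).sub contDiff_const))).contDiffAt
  have hd : ∀ v : Fin 2 → ℂ, fderiv ℝ (fun z : Fin 2 → ℂ =>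
      ![(⟨(z 0).re + (b + r (z 1).re), (z 0).im⟩ : ℂ),
        ⟨(z 1).re, (z 1).im - deriv r (z 1).re * ((z 0).im - v₀)⟩]) z v
      = ![⟨(v 0).re + deriv r (z 1).re * (v 1).re, (v 0).im⟩,
        ⟨(v 1).re, (v 1).im - (deriv (deriv r) (z 1).re * (v 1).re * ((z 0).im - v₀)
          + deriv r (z 1).re * (v 0).im)⟩] := by
    intro v
    refine fderiv_apply_eq_of_hasDerivAt (hs.differentiableAt (by simp)) ?_
    have lre : ∀ i, HasDerivAt (fun t : ℝ => ((z + t • v) i).re) (v i).re 0 := fun i =>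
      hasDerivAt_re_line (z i) (v i) 0
    have lim : ∀ i, HasDerivAt (fun t : ℝ => ((z + t • v) i).im) (v i).im 0 := fun i =>
      hasDerivAt_im_line (z i) (v i) 0
    have e0 : z + (0 : ℝ) • v = z := by simp
    have lift : ∀ {g : ℝ → ℝ}, ContDiff ℝ ∞ g → HasDerivAt (fun t : ℝ => g ((z + t • v) 1).re)
        (deriv g (z 1).re * (v 1).re) 0 := by
      intro g hg
      have h1 := (hg.contDiffAt.differentiableAt (x := ((z + (0 : ℝ) • v) 1).re)
        (by simp)).hasDerivAt
      have := HasDerivAt.comp (h₂ := g) (0 : ℝ) h1 (lre 1)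
      rwa [e0] at this
    refine hasDerivAt_pi.2 fun i => ?_
    fin_cases i
    · exact ((lre 0).add ((lift hr).const_add b)).complexMk (lim 0)
    · have := (lre 1).complexMk ((lim 1).sub ((lift hr').mul ((lim 0).sub_const v₀)))
      rw [e0] at this
      exact this
  refine ⟨hs, fun v w => ?_⟩
  rw [hd, hd]
  simp only [stdSymplecticForm, Fin.sum_univ_two, Matrix.cons_val_zero, Matrix.cons_val_one]
  ring

/-- The numerical data of the embedding: `c` is a smooth step of height `w` and width at most `L`,
and `A` is the size of the ball. -/
structure FoldData where
  (A w d L : ℝ)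
  k : ℕ
  c : ℝ → ℝ
  one_le_k : 1 ≤ k
  d_pos : 0 < d
  five_d_lt : 5 * d < 1
  w_pos : 0 < w
  w_le : w ≤ L
  d_lt : d < L
  L_lt : L < A - w - (2 * k - 1) * L
  contDiff_c : ContDiff ℝ ∞ c
  c_eq_zero : ∀ s ≤ d, c s = 0
  c_eq_w : ∀ s, L ≤ s → c s = w
  deriv_c : ∀ s, 0 ≤ deriv c s ∧ deriv c s ≤ 1 - 2 * d

namespace FoldData

variable (D : FoldData)

/-- The `j`-th stair on the outer side starts at the height `Q j` and ends at `Q (j + 1)`. -/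
def Q (j : ℕ) : ℝ := D.A - D.w - ((j : ℝ) - 1) * D.L

theorem L_pos : 0 < D.L := D.d_pos.trans D.d_lt

theorem Q_succ (j : ℕ) : D.Q (j + 1) = D.Q j - D.L := by
  simp only [Q]; push_cast; ring

theorem antitone_Q : Antitone D.Q :=
  antitone_nat_of_succ_le fun j => by rw [D.Q_succ]; linarith [D.L_pos]

theorem L_lt_Q : D.L < D.Q (2 * D.k) := by
  have := D.L_lt
  simp only [Q]; push_cast; exact this

theorem L_lt_Q_of_le {j : ℕ} (hj : j ≤ 2 * D.k) : D.L < D.Q j :=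
  D.L_lt_Q.trans_le (D.antitone_Q hj)

theorem monotone_c : Monotone D.c :=
  monotone_of_deriv_nonneg (D.contDiff_c.differentiable (by simp)) fun s => (D.deriv_c s).1

theorem c_nonneg (s : ℝ) : 0 ≤ D.c s := by
  have := D.monotone_c (min_le_left s D.d)
  rwa [D.c_eq_zero _ (min_le_right _ _)] at this

theorem c_le (s : ℝ) : D.c s ≤ D.w := by
  have := D.monotone_c (le_max_left s D.L)
  rwa [D.c_eq_w _ (le_max_right _ _)] at this

theorem c_le_self {s : ℝ} (hs : 0 ≤ s) : D.c s ≤ s := by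
  have h := image_sub_le_mul_sub_of_deriv_le (C := 1) (D.contDiff_c.differentiable (by simp))
    (fun s => by linarith [(D.deriv_c s).2, D.d_pos]) hs
  rw [D.c_eq_zero 0 D.d_pos.le] at h
  linarith

open Classical in
/-- The bounds for the projection to the `z₁`-plane before lifting. -/
noncomputable def bounds : CombBounds where
  bot j := if j = 0 ∨ j + 1 = 2 * D.k then 0 else D.L
  top j := if Even j then D.Q (j + 2) else D.Q (j + 1)
  lo j := if Even j then 0 else D.L
  hi j := if Even j then D.Q (min (j + 2) (2 * D.k)) else D.Q j
  gateLo j := if Even j then 0 else D.Q j - D.d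
  gateHi j := if Even j then D.d else D.Q j

theorem compatible_bounds : D.bounds.Compatible (2 * D.k) D.L (D.Q (2 * D.k)) where
  nonneg := D.L_pos.le
  lt := D.L_lt_Q
  lo j _ := by
    have := D.L_pos
    simp only [bounds]; split_ifs <;> constructor <;> linarith
  hi j hj := by
    simp only [bounds]; split_ifs
    · exact D.antitone_Q (min_le_right _ _)
    · exact D.antitone_Q hj
  bot j _ := by
    have := D.L_pos
    simp only [bounds]; split_ifs <;> constructor <;> linarith
  top j hj := by
    simp only [bounds]; split_ifs with h
    · rw [Nat.even_iff] at h
      exact D.antitone_Q (by omega)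
    · exact D.antitone_Q hj
  gate j hj hj1 := by
    have h1 := D.d_pos
    have h2 := D.d_lt
    simp only [bounds]; split_ifs with h
    · exact ⟨le_rfl, h1, (h2.trans (D.L_lt_Q_of_le (min_le_right _ _))).le⟩
    · have h3 := D.L_lt_Q_of_le (j := j + 1) hj
      rw [D.Q_succ] at h3
      exact ⟨by linarith, by linarith, le_rfl⟩

/-! ### Stairs are reached only near gates -/

section PointwiseBounds

variable {D} {p q f h : ℝ} {j : ℕ}

/-- This and the next three lemmas say where the comb meets a stair: over chamber `j`, its own stair
is reached only within `d` of the left gate, and the stair of chamber `j + 1` only within `d` of the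
right gate. -/
theorem lt_Q_of_not_even (H : IsComb D.bounds (2 * D.k) D.d p f h) (hq : q < f + h)
    (hj : j < 2 * D.k) (h1 : (j : ℝ) ≤ p) (h2 : p < j + 1) (he : ¬ Even j) :
    q < D.Q j ∧ (j + D.d ≤ p → q < D.Q (j + 1)) := by
  have hdp := D.d_pos
  have hmain : j + D.d ≤ p → q < D.Q (j + 1) := by
    intro h3
    rcases le_total p (j + 1 - D.d) with h4 | h4
    · have := (H.middle j hj h3 h4).2
      simp only [bounds, if_neg he] at this
      linarith
    · have h5 := (H.near (j + 1) hj (by push_cast; linarith) (by push_cast; linarith)).2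
      have he' : Even (j + 1) := by rw [Nat.even_add_one]; exact he
      simp only [bounds, if_pos he'] at h5
      have := D.antitone_Q (show j + 1 ≤ min (j + 1 + 2) (2 * D.k) by omega)
      linarith
  refine ⟨?_, hmain⟩
  rcases le_total p (j + D.d) with h3 | h3
  · have := (H.near j hj.le (by linarith) h3).2
    simp only [bounds, if_neg he] at this
    linarith
  · exact (hmain h3).trans_le (D.antitone_Q (Nat.le_succ j))

theorem L_lt_of_not_even (H : IsComb D.bounds (2 * D.k) D.d p f h) (hf : f < q)
    (hj : j + 1 < 2 * D.k) (h1 : (j : ℝ) ≤ p) (he : ¬ Even j) (h2 : p ≤ j + 1 - D.d) :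
    D.L < q := by
  have hdp := D.d_pos
  rcases le_total p (j + D.d) with h3 | h3
  · have := (H.near j (by omega) (by linarith) h3).1
    simp only [bounds, if_neg he] at this
    linarith
  · have := (H.middle j (by omega) h3 h2).1
    have hj0 : ¬ (j = 0 ∨ j + 1 = 2 * D.k) := by
      rintro (rfl | h)
      · exact he Even.zero
      · omega
    simp only [bounds, if_neg hj0] at this
    linarith

theorem lt_Q_of_even (H : IsComb D.bounds (2 * D.k) D.d p f h) (hq : q < f + h)
    (hj : j < 2 * D.k) (h1 : (j : ℝ) ≤ p) (h2 : p < j + 1) (he : Even j) :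
    q < D.Q (j + 1) ∧ (p ≤ j + 1 - D.d → q < D.Q (j + 2)) := by
  have hdp := D.d_pos
  have hj2 : j + 2 ≤ 2 * D.k := by rw [Nat.even_iff] at he; omega
  have hmain : p ≤ j + 1 - D.d → q < D.Q (j + 2) := by
    intro h3
    rcases le_total p (j + D.d) with h4 | h4
    · have := (H.near j hj.le (by linarith) h4).2
      simp only [bounds, if_pos he, min_eq_left hj2] at this
      linarith
    · have := (H.middle j hj h4 h3).2
      simp only [bounds, if_pos he] at this
      linarith
  refine ⟨?_, hmain⟩
  rcases le_total p (j + 1 - D.d) with h3 | h3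
  · exact (hmain h3).trans_le (D.antitone_Q (by omega))
  · have h5 := (H.near (j + 1) hj (by push_cast; linarith) (by push_cast; linarith)).2
    have he' : ¬ Even (j + 1) := by rw [Nat.even_add_one]; exact not_not.2 he
    simp only [bounds, if_neg he'] at h5
    linarith

theorem L_lt_of_even (H : IsComb D.bounds (2 * D.k) D.d p f h) (hf : f < q)
    (hj : j < 2 * D.k) (h2 : p < j + 1) (he : Even j) (hj1 : 1 ≤ j)
    (h1 : j + D.d ≤ p) : D.L < q := by
  have hdp := D.d_pos
  rcases le_total p (j + 1 - D.d) with h3 | h3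
  · have := (H.middle j hj h1 h3).1
    have hj0 : ¬ (j = 0 ∨ j + 1 = 2 * D.k) := by
      rw [Nat.even_iff] at he
      omega
    simp only [bounds, if_neg hj0] at this
    linarith
  · have h5 := (H.near (j + 1) hj (by push_cast; linarith) (by push_cast; linarith)).1
    have he' : ¬ Even (j + 1) := by rw [Nat.even_add_one]; exact not_not.2 he
    simp only [bounds, if_neg he'] at h5
    linarith

end PointwiseBounds

/-! ### The pieces of the lift -/

open Classical in
/-- The part of the lift that takes place over `[j, j + 1)`. -/
noncomputable def rise (j : ℕ) (q : ℝ) : ℝ :=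
  if j = 0 then D.w else if Even j then D.c q else D.c (D.Q j - q)

open Classical in
/-- The value of `v` whose orbit is not moved in the direction of `p`. -/
noncomputable def center (j : ℕ) : ℝ := if Even j then 1 else 0

theorem contDiff_rise (j : ℕ) : ContDiff ℝ ∞ (D.rise j) := by
  unfold rise
  split_ifs
  · exact contDiff_const
  · exact D.contDiff_c
  · exact D.contDiff_c.comp (contDiff_const.sub contDiff_id)

theorem rise_nonneg (j : ℕ) (q : ℝ) : 0 ≤ D.rise j q := by
  unfold rise
  split_ifs
  exacts [D.w_pos.le, D.c_nonneg _, D.c_nonneg _]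

theorem rise_le (j : ℕ) (q : ℝ) : D.rise j q ≤ D.w := by
  unfold rise
  split_ifs
  exacts [le_rfl, D.c_le _, D.c_le _]

theorem deriv_rise (j : ℕ) (q : ℝ) : deriv (D.rise j) q =
    if j = 0 then 0 else if Even j then deriv D.c q else - deriv D.c (D.Q j - q) := by
  by_cases h0 : j = 0
  · have : D.rise j = fun _ => D.w := by funext; simp [rise, h0]
    rw [this, if_pos h0, deriv_const]
  · by_cases he : Even j
    · have : D.rise j = D.c := by funext; simp [rise, h0, he]
      rw [this, if_neg h0, if_pos he]
    · have : D.rise j = fun q => D.c (D.Q j - q) := by funext; simp [rise, h0, he]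
      rw [this, if_neg h0, if_neg he, deriv_comp_const_sub]

/-- The slope of `rise` is nonnegative for even `j` and nonpositive for odd `j`; `center`
compensates, so that `p` always moves forward. The bound `1 - 2d` leaves room for a margin `d` on
either side of a gate. -/
theorem shift_bounds (j : ℕ) (q : ℝ) {v : ℝ} (hv0 : 0 < v) (hv1 : v < 1) :
    0 ≤ -(deriv (D.rise j) q * (v - center j)) ∧
      -(deriv (D.rise j) q * (v - center j)) ≤ 1 - 2 * D.d := by
  have hd := D.five_d_lt
  have hdp := D.d_pos
  rw [D.deriv_rise, center]
  split_ifs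
  · constructor <;> linarith
  · constructor <;> linarith
  · obtain ⟨h1, h2⟩ := D.deriv_c q
    constructor <;> nlinarith
  · obtain ⟨h1, h2⟩ := D.deriv_c (D.Q j - q)
    constructor <;> nlinarith

theorem rise_eventuallyEq_zero_of_even {j : ℕ} {q : ℝ} (hj : 1 ≤ j) (he : Even j)
    (hq : q < D.d) : D.rise j =ᶠ[nhds q] fun _ => 0 := by
  filter_upwards [eventually_lt_nhds hq] with x hx
  rw [rise, if_neg (by omega), if_pos he, D.c_eq_zero _ hx.le]

theorem rise_eventuallyEq_zero_of_not_even {j : ℕ} {q : ℝ} (he : ¬ Even j)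
    (hq : D.Q j - D.d < q) : D.rise j =ᶠ[nhds q] fun _ => 0 := by
  filter_upwards [eventually_gt_nhds hq] with x hx
  rw [rise, if_neg (by rintro rfl; exact he Even.zero), if_neg he,
    D.c_eq_zero _ (by linarith)]

theorem rise_eventuallyEq_w_of_even {j : ℕ} {q : ℝ} (he : Even j)
    (hq : j = 0 ∨ D.L < q) : D.rise j =ᶠ[nhds q] fun _ => D.w := by
  rcases hq with rfl | hq
  · exact Filter.Eventually.of_forall fun x => by simp [rise]
  · filter_upwards [eventually_gt_nhds hq] with x hx
    rw [rise]
    split_ifs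
    · rfl
    · exact D.c_eq_w _ hx.le

theorem rise_eventuallyEq_w_of_not_even {j : ℕ} {q : ℝ} (he : ¬ Even j)
    (hq : q < D.Q (j + 1)) : D.rise j =ᶠ[nhds q] fun _ => D.w := by
  filter_upwards [eventually_lt_nhds hq] with x hx
  rw [D.Q_succ] at hx
  rw [rise, if_neg (by rintro rfl; exact he Even.zero), if_neg he, D.c_eq_w _ (by linarith)]

theorem deriv_eq_zero_of_eventuallyEq_const {r : ℝ → ℝ} {q b : ℝ} (h : r =ᶠ[nhds q] fun _ => b) :
    deriv r q = 0 := by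
  rw [h.deriv_eq, deriv_const]

/-- The lift over `[j, j + 1)`. -/
noncomputable def liftPiece (j : ℕ) (z : Fin 2 → ℂ) : Fin 2 → ℂ :=
  ![⟨(z 0).re + (((j : ℝ) - 1) * D.w + D.rise j (z 1).re), (z 0).im⟩,
    ⟨(z 1).re, (z 1).im - deriv (D.rise j) (z 1).re * ((z 0).im - center j)⟩]

/-- The lift. -/
noncomputable def lift (z : Fin 2 → ℂ) : Fin 2 → ℂ := D.liftPiece ⌊(z 1).im⌋₊ z

theorem symplecticAt_liftPiece (j : ℕ) (z : Fin 2 → ℂ) : SymplecticAt (D.liftPiece j) z :=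
  symplecticAt_lift (D.contDiff_rise j) _ _ z

/-- The domain of the lift. -/
def domain (f h : ℝ → ℝ) : Set (Fin 2 → ℂ) :=
  {z | 0 < (z 0).re ∧ (z 0).re < D.w ∧ 0 < (z 0).im ∧ (z 0).im < 1 ∧ 0 < (z 1).im ∧
    (z 1).im < (2 * D.k : ℕ) ∧ f (z 1).im < (z 1).re ∧
    (z 1).re < f (z 1).im + h (z 1).im}

/-! ### Gluing, containment and injectivity of the lift -/

variable {D} {f h : ℝ → ℝ} (H : ∀ p, IsComb D.bounds (2 * D.k) D.d p (f p) (h p))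

include H

/-- At the gate the new stair has not begun and the old one is complete, so both pieces raise `u` by
`jw` and fix `p`. -/
theorem rise_at_gate {j : ℕ} {q : ℝ} (hj : j + 1 < 2 * D.k) (hf : f ((j + 1 : ℕ) : ℝ) < q)
    (hq : q < f ((j + 1 : ℕ) : ℝ) + h ((j + 1 : ℕ) : ℝ)) :
    (D.rise (j + 1) =ᶠ[nhds q] fun _ => 0) ∧ (D.rise j =ᶠ[nhds q] fun _ => D.w) := by
  have hg := (H ((j + 1 : ℕ) : ℝ)).gate (j + 1) hj (by omega) le_rfl le_rfl
  have hdL := D.d_lt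
  by_cases he : Even j
  · have he' : ¬ Even (j + 1) := by rw [Nat.even_add_one]; exact not_not.2 he
    simp only [bounds, if_neg he'] at hg
    refine ⟨D.rise_eventuallyEq_zero_of_not_even he' (by linarith),
      D.rise_eventuallyEq_w_of_even he (Or.inr ?_)⟩
    have h3 := D.L_lt_Q_of_le (j := j + 2) hj
    rw [D.Q_succ (j + 1)] at h3
    linarith
  · have he' : Even (j + 1) := by rw [Nat.even_add_one]; exact he
    simp only [bounds, if_pos he'] at hg
    refine ⟨D.rise_eventuallyEq_zero_of_even (by omega) he' (by linarith),
      D.rise_eventuallyEq_w_of_not_even he ?_⟩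
    have h3 := D.L_lt_Q_of_le (j := j + 1) hj.le
    linarith

theorem symplecticAt_lift_of_mem {z : Fin 2 → ℂ} (hz : z ∈ D.domain f h) :
    SymplecticAt D.lift z := by
  obtain ⟨-, -, -, -, hp0, hpn, hf, hq⟩ := hz
  have hcim : Filter.Tendsto (fun z : Fin 2 → ℂ => (z 1).im) (nhds z) (nhds (z 1).im) :=
    (Complex.continuous_im.comp (continuous_apply 1)).continuousAt
  have hcre : Filter.Tendsto (fun z : Fin 2 → ℂ => (z 1).re) (nhds z) (nhds (z 1).re) :=
    (Complex.continuous_re.comp (continuous_apply 1)).continuousAt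
  set j := ⌊(z 1).im⌋₊ with hjdef
  have h1 : (j : ℝ) ≤ (z 1).im := Nat.floor_le hp0.le
  have h2 : (z 1).im < j + 1 := Nat.lt_floor_add_one _
  refine (D.symplecticAt_liftPiece j z).congr ?_
  rcases h1.eq_or_lt with h3 | h3
  · obtain ⟨i, hi⟩ : ∃ i, j = i + 1 := Nat.exists_eq_succ_of_ne_zero fun h0 => by
      rw [h0] at h3; push_cast at h3; linarith
    have hjn : i + 1 < 2 * D.k := by
      rw [← hi]; rw [← h3] at hpn; exact_mod_cast hpn
    rw [← h3, hi] at hf hq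
    obtain ⟨g1, g2⟩ := rise_at_gate H hjn hf hq
    filter_upwards [hcim.eventually (eventually_lt_nhds h2),
      hcim.eventually (eventually_gt_nhds (show (i : ℝ) < (z 1).im by
        rw [← h3, hi]; push_cast; linarith)),
      hcre.eventually g1.eventuallyEq_nhds, hcre.eventually g2.eventuallyEq_nhds]
      with z' a1 a2 a3 a4
    rcases le_or_gt (j : ℝ) (z' 1).im with a5 | a5
    · have : ⌊(z' 1).im⌋₊ = j := (Nat.floor_eq_iff ((Nat.cast_nonneg j).trans a5)).2 ⟨a5, a1⟩
      rw [lift, this]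
    · have : ⌊(z' 1).im⌋₊ = i := (Nat.floor_eq_iff ((Nat.cast_nonneg i).trans a2.le)).2
        ⟨a2.le, by rw [hi] at a5; push_cast at a5; exact a5⟩
      rw [lift, this, hi, liftPiece, liftPiece, a3.self_of_nhds, a4.self_of_nhds,
        deriv_eq_zero_of_eventuallyEq_const a3, deriv_eq_zero_of_eventuallyEq_const a4]
      push_cast
      congr 3
      · ring
      · ring_nf
  · filter_upwards [hcim.eventually (eventually_lt_nhds h2),
      hcim.eventually (eventually_gt_nhds h3)] with z' a1 a2
    have : ⌊(z' 1).im⌋₊ = j := (Nat.floor_eq_iff ((Nat.cast_nonneg j).trans a2.le)).2 ⟨a2.le, a1⟩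
    rw [lift, this]

/-- The lift stays in the region `u + q < A`. -/
theorem lift_bounds {z : Fin 2 → ℂ} (hz : z ∈ D.domain f h) :
    0 < (D.lift z 0).re ∧ 0 < (D.lift z 1).re ∧ (D.lift z 0).re + (D.lift z 1).re < D.A := by
  obtain ⟨hu0, huw, -, -, hp0, hpn, hf, hq⟩ := hz
  have h1 : (⌊(z 1).im⌋₊ : ℝ) ≤ (z 1).im := Nat.floor_le hp0.le
  have h2 : (z 1).im < ⌊(z 1).im⌋₊ + 1 := Nat.lt_floor_add_one _
  have hj : ⌊(z 1).im⌋₊ < 2 * D.k := by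
    rw [Nat.floor_lt hp0.le]; exact hpn
  simp only [lift, liftPiece, Matrix.cons_val_zero, Matrix.cons_val_one]
  generalize ⌊(z 1).im⌋₊ = j at h1 h2 hj ⊢
  have hq0 : 0 < (z 1).re := (H _).f_pos.trans hf
  have hw := D.w_pos
  have hwL := D.w_le
  have hr0 := D.rise_nonneg j (z 1).re
  have hr1 := D.rise_le j (z 1).re
  refine ⟨?_, hq0, ?_⟩
  · rcases Nat.eq_zero_or_pos j with rfl | hj1
    · simp only [rise, if_pos]; push_cast; linarith
    · have : (1 : ℝ) ≤ j := by exact_mod_cast hj1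
      nlinarith
  · have key : (z 1).re < D.Q (j + 1) →
        (z 0).re + (((j : ℝ) - 1) * D.w + D.rise j (z 1).re) + (z 1).re < D.A := by
      intro h3
      simp only [Q] at h3
      push_cast at h3
      have : (j : ℝ) * D.w ≤ j * D.L := mul_le_mul_of_nonneg_left hwL (Nat.cast_nonneg j)
      linarith
    by_cases he : Even j
    · exact key (lt_Q_of_even (H _) hq hj h1 h2 he).1
    · have h3 := (lt_Q_of_not_even (H _) hq hj h1 h2 he).1
      have hj0 : j ≠ 0 := by rintro rfl; exact he Even.zero
      have hj1 : (1 : ℝ) ≤ j := by exact_mod_cast Nat.one_le_iff_ne_zero.2 hj0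
      -- An odd stair starts at the top and descends: as its slope is at most `1`, `u` gains no more
      -- than `q` has lost.
      have h4 : D.rise j (z 1).re ≤ D.Q j - (z 1).re := by
        rw [rise, if_neg hj0, if_neg he]
        exact D.c_le_self (by linarith)
      have : ((j : ℝ) - 1) * D.w ≤ (j - 1) * D.L :=
        mul_le_mul_of_nonneg_left hwL (by linarith)
      simp only [Q] at h4
      linarith

/-- Points over different intervals cannot have lifts with the same `u`, `v`, `q` and the same `p`
modulo `1`. -/
theorem lift_ne_of_floor_lt {z z' : Fin 2 → ℂ} (hz : z ∈ D.domain f h) (hz' : z' ∈ D.domain f h)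
    (hlt : ⌊(z 1).im⌋₊ < ⌊(z' 1).im⌋₊) (h0 : (D.lift z 0).re = (D.lift z' 0).re)
    (h1 : (D.lift z 1).re = (D.lift z' 1).re) (m : ℤ) :
    (D.lift z 1).im ≠ (D.lift z' 1).im + m := by
  intro h2
  obtain ⟨hu0, huw, hv0, hv1, hp0, hpn, hf, hq⟩ := hz
  obtain ⟨hu0', huw', hv0', hv1', hp0', hpn', hf', hq'⟩ := hz'
  have a1 : (⌊(z 1).im⌋₊ : ℝ) ≤ (z 1).im := Nat.floor_le hp0.le
  have a2 : (z 1).im < ⌊(z 1).im⌋₊ + 1 := Nat.lt_floor_add_one _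
  have b1 : (⌊(z' 1).im⌋₊ : ℝ) ≤ (z' 1).im := Nat.floor_le hp0'.le
  have b2 : (z' 1).im < ⌊(z' 1).im⌋₊ + 1 := Nat.lt_floor_add_one _
  have hj : ⌊(z' 1).im⌋₊ < 2 * D.k := by
    rw [Nat.floor_lt hp0'.le]; exact hpn'
  simp only [lift, liftPiece, Matrix.cons_val_zero, Matrix.cons_val_one] at h0 h1 h2
  generalize ⌊(z 1).im⌋₊ = i at a1 a2 hlt h0 h2
  generalize ⌊(z' 1).im⌋₊ = j at b1 b2 hj hlt h0 h2
  rw [← h1] at h0 h2 hf' hq'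
  have hw := D.w_pos
  have hdp := D.d_pos
  have ri := D.rise_le i (z 1).re
  have rj := D.rise_nonneg j (z 1).re
  -- The lifted values of `u` over chamber `i` lie between `(i - 1)w` and `(i + 1)w`.
  have hji : j = i + 1 := by
    by_contra hne
    have : (i : ℝ) + 2 ≤ j := by exact_mod_cast (show i + 2 ≤ j by omega)
    nlinarith
  subst hji
  push_cast at h0
  have hrj : D.rise (i + 1) (z 1).re < D.w := by linarith
  -- Near the common gate, the lifted `p` over chamber `i + 1` minus that over chamber `i` lies
  -- strictly between `0` and `1`, so `-1 < m < 0`.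
  have hfin : (D.rise i =ᶠ[nhds (z 1).re] fun _ => D.w) → (i : ℝ) + 1 - D.d < (z 1).im →
      (z' 1).im < (i + 1 : ℕ) + D.d → False := by
    intro c1 c2 c3
    rw [deriv_eq_zero_of_eventuallyEq_const c1] at h2
    have := D.shift_bounds (i + 1) (z 1).re hv0' hv1'
    push_cast at b1 c3
    have d1 : (m : ℝ) < 0 := by linarith
    have d2 : (-1 : ℝ) < m := by linarith
    have d3 : m < 0 := by exact_mod_cast d1
    have d4 : -1 < m := by exact_mod_cast d2
    omega
  by_cases he : Even i
  · have he' : ¬ Even (i + 1) := by rw [Nat.even_add_one]; exact not_not.2 he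
    have hq2 : D.Q (i + 2) ≤ (z 1).re := by
      by_contra! hcon
      exact hrj.ne (D.rise_eventuallyEq_w_of_not_even he' hcon).self_of_nhds
    refine hfin (D.rise_eventuallyEq_w_of_even he (Or.inr ?_)) ?_ ?_
    · exact (D.L_lt_Q_of_le hj).trans_le hq2
    · by_contra! hcon
      exact absurd ((lt_Q_of_even (H _) hq (by omega) a1 a2 he).2 hcon) (not_lt.2 hq2)
    · by_contra! hcon
      exact absurd ((lt_Q_of_not_even (H _) hq' hj b1 b2 he').2 hcon) (not_lt.2 hq2)
  · have he' : Even (i + 1) := by rw [Nat.even_add_one]; exact he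
    have hq2 : (z 1).re ≤ D.L := by
      by_contra! hcon
      exact hrj.ne (D.rise_eventuallyEq_w_of_even he' (Or.inr hcon)).self_of_nhds
    refine hfin (D.rise_eventuallyEq_w_of_not_even he ?_) ?_ ?_
    · exact hq2.trans_lt (D.L_lt_Q_of_le hj.le)
    · by_contra! hcon
      exact absurd (L_lt_of_not_even (H _) hf hj a1 he hcon) (not_lt.2 hq2)
    · by_contra! hcon
      exact absurd (L_lt_of_even (H _) hf' hj b2 he' (by omega) hcon) (not_lt.2 hq2)

theorem injOn_actionAngle_lift :
    Set.InjOn (fun z i => actionAngle (D.lift z i)) (D.domain f h) := by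
  intro z hz z' hz' heq
  obtain ⟨l0, l1, -⟩ := lift_bounds H hz
  obtain ⟨l0', l1', -⟩ := lift_bounds H hz'
  obtain ⟨e0, m0, e0'⟩ := actionAngle_eq_iff l0 l0' (congrFun heq 0)
  obtain ⟨e1, m1, e1'⟩ := actionAngle_eq_iff l1 l1' (congrFun heq 1)
  have hfl : ⌊(z 1).im⌋₊ = ⌊(z' 1).im⌋₊ := by
    rcases lt_trichotomy ⌊(z 1).im⌋₊ ⌊(z' 1).im⌋₊ with hlt | h | hlt
    · exact (lift_ne_of_floor_lt H hz hz' hlt e0 e1 m1 e1').elim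
    · exact h
    · exact (lift_ne_of_floor_lt H hz' hz hlt e0.symm e1.symm (-m1) (by push_cast; linarith)).elim
  obtain ⟨-, -, hv0, hv1, hp0, -, -, -⟩ := hz
  obtain ⟨-, -, hv0', hv1', hp0', -, -, -⟩ := hz'
  have a1 : (⌊(z 1).im⌋₊ : ℝ) ≤ (z 1).im := Nat.floor_le hp0.le
  have a2 : (z 1).im < ⌊(z 1).im⌋₊ + 1 := Nat.lt_floor_add_one _
  have b1 : (⌊(z' 1).im⌋₊ : ℝ) ≤ (z' 1).im := Nat.floor_le hp0'.le
  have b2 : (z' 1).im < ⌊(z' 1).im⌋₊ + 1 := Nat.lt_floor_add_one _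
  simp only [lift, liftPiece, Matrix.cons_val_zero, Matrix.cons_val_one] at e0 e0' e1 e1'
  have int_zero : ∀ {m : ℤ}, (-1 : ℝ) < m → (m : ℝ) < 1 → (m : ℝ) = 0 := by
    intro m h1 h2
    have h1 : -1 < m := by exact_mod_cast h1
    have h2 : m < 1 := by exact_mod_cast h2
    have : m = 0 := by omega
    simp [this]
  -- Over one chamber, two values of `v` in `(0, 1)` agree modulo `1` only if equal. Then the shifts
  -- of `p` coincide, and the same argument applies to `p`.
  have hv : (z 0).im = (z' 0).im := by
    rw [int_zero (m := m0) (by linarith) (by linarith)] at e0'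
    linarith
  rw [← hfl] at e0 e1' b1 b2
  rw [← e1] at e0 e1'
  rw [← hv] at e1'
  have hp : (z 1).im = (z' 1).im := by
    rw [int_zero (m := m1) (by linarith) (by linarith)] at e1'
    linarith
  have hu : (z 0).re = (z' 0).re := by linarith
  funext i
  fin_cases i
  · exact Complex.ext hu hv
  · exact Complex.ext e1 hp

end FoldData

/-! ### The area count and the optimal ball -/

namespace FoldData

/-- Chambers `2i` and `2i + 1` have the same top `Q (2i + 2)`, the lower end of the descending stair
between them. -/
theorem sum_top (D : FoldData) :
    ∑ j ∈ Finset.range (2 * D.k), D.bounds.top j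
      = 2 * D.k * (D.A - D.w) - 2 * (D.k : ℝ) ^ 2 * D.L := by
  have key : ∀ k : ℕ, ∑ j ∈ Finset.range (2 * k), D.bounds.top j
      = 2 * k * (D.A - D.w) - 2 * (k : ℝ) ^ 2 * D.L := by
    intro k
    induction k with
    | zero => simp
    | succ k ih =>
      have he : Even (2 * k) := even_two_mul k
      have he' : ¬ Even (2 * k + 1) := by rw [Nat.even_add_one]; exact not_not.2 he
      rw [show 2 * (k + 1) = 2 * k + 1 + 1 by ring, Finset.sum_range_succ, Finset.sum_range_succ,
        ih]
      simp only [bounds, if_pos he, if_neg he', Q]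
      push_cast
      ring
  exact key D.k

/-- All chambers lose the strip `q < L` to an even stair, except the first, which has no stair, and
the last, which has no successor. -/
theorem sum_bot (D : FoldData) :
    ∑ j ∈ Finset.range (2 * D.k), D.bounds.bot j = (2 * D.k - 2) * D.L := by
  have hk := D.one_le_k
  obtain ⟨m, hm⟩ : ∃ m, 2 * D.k = m + 2 := ⟨2 * D.k - 2, by omega⟩
  have hm' : (2 * D.k : ℝ) = m + 2 := by exact_mod_cast hm
  have h1 : ∀ j ∈ Finset.range m, D.bounds.bot (j + 1) = D.L := by
    intro j hj
    rw [Finset.mem_range] at hj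
    simp only [bounds]
    rw [if_neg (by omega)]
  have h2 : D.bounds.bot 0 = 0 := by simp [bounds]
  have h3 : D.bounds.bot (m + 1) = 0 := by
    simp only [bounds]
    rw [if_pos (by omega)]
  rw [hm, Finset.sum_range_succ, Finset.sum_range_succ', Finset.sum_congr rfl h1, h2, h3, hm']
  simp

theorem symplecticallyEmbeds (D : FoldData) {a : ℝ} (ha : 0 < a) (hw : π < D.w)
    (harea : a < (1 - 4 * D.d) * (2 * D.k * (D.A - D.w) - 2 * (D.k : ℝ) ^ 2 * D.L
      - (2 * D.k - 2) * D.L - 2 * D.k * D.d)) :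
    SymplecticallyEmbeds (polydisc ![π, a]) (symplecticBall 2 D.A) := by
  obtain ⟨f, h, hf, hh, H⟩ := exists_contDiff_isComb D.compatible_bounds D.d_pos D.five_d_lt
  have hint : a < ∫ p in (0 : ℝ)..((2 * D.k : ℕ) : ℝ), h p := by
    refine lt_of_lt_of_le ?_ (le_integral_of_isComb D.d_pos D.five_d_lt hh.continuous H)
    rw [← Finset.mul_sum, Finset.sum_sub_distrib, Finset.sum_sub_distrib, D.sum_top, D.sum_bot,
      Finset.sum_const, Finset.card_range, nsmul_eq_mul]
    push_cast
    exact harea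
  obtain ⟨g₀, hg₀i, hg₀⟩ := exists_areaPreserving_openDisc_rectangle Real.pi_pos hw
  obtain ⟨g₁, hg₁i, hg₁⟩ := exists_areaPreserving_openDisc_graph hf hh (fun p => (H p).h_pos)
    (Nat.cast_nonneg _) ha hint
  let g : Fin 2 → ℂ → ℂ := ![g₀, g₁]
  let G : (Fin 2 → ℂ) → (Fin 2 → ℂ) := fun z i => g i (z i)
  have hmem : ∀ z ∈ polydisc ![π, a], G z ∈ D.domain f h := by
    intro z hz
    obtain ⟨-, r1, r2, r3, r4⟩ := hg₀ (z 0) (hz 0)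
    obtain ⟨-, s1, s2, s3, s4⟩ := hg₁ (z 1) (hz 1)
    exact ⟨r1, r2, r3, r4, s1, s2, s3, s4⟩
  have hG : ∀ z ∈ polydisc ![π, a], SymplecticAt G z := by
    intro z hz
    refine SymplecticAt.pi fun i => ?_
    fin_cases i
    · exact (hg₀ (z 0) (hz 0)).1
    · exact (hg₁ (z 1) (hz 1)).1
  have hGi : Set.InjOn G (polydisc ![π, a]) := by
    intro z hz z' hz' heq
    funext i
    fin_cases i
    · exact hg₀i (hz 0) (hz' 0) (congrFun heq 0)
    · exact hg₁i (hz 1) (hz' 1) (congrFun heq 1)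
  refine ⟨(fun z i => actionAngle (z i)) ∘ D.lift ∘ G,
    isSymplecticEmbedding_of_injOn (isOpen_polydisc _) ?_ ?_ ?_⟩
  · intro z hz
    obtain ⟨l0, l1, -⟩ := lift_bounds H (hmem z hz)
    refine SymplecticAt.comp (SymplecticAt.pi fun i => ?_)
      ((symplecticAt_lift_of_mem H (hmem z hz)).comp (hG z hz))
    fin_cases i
    · exact areaPreservingAt_actionAngle l0
    · exact areaPreservingAt_actionAngle l1
  · exact (injOn_actionAngle_lift H).comp hGi hmem
  · intro z hz
    obtain ⟨l0, l1, l2⟩ := lift_bounds H (hmem z hz)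
    have hA : 0 < D.A := by linarith
    simp only [symplecticBall, symplecticEllipsoid, Set.mem_ofPred_eq, Fin.sum_univ_two,
      Function.comp_apply]
    rw [pi_mul_norm_actionAngle_sq l0.le, pi_mul_norm_actionAngle_sq l1.le, ← add_div,
      div_lt_one hA]
    exact l2

end FoldData

/-- The two strict inequalities are the room and area conditions at `d = 0`, where `w = L = π`; by
continuity they persist for small `d > 0`. -/
theorem symplecticallyEmbeds_polydisc_ball {a A : ℝ} {k : ℕ} (ha : 0 < a) (hk : 1 ≤ k)
    (hA : (2 * k + 1) * π < A) (harea : a < 2 * k * A - 4 * k * π - 2 * k ^ 2 * π + 2 * π) :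
    SymplecticallyEmbeds (polydisc ![π, a]) (symplecticBall 2 A) := by
  -- The length `exists_smooth_step` needs to climb `π + d` with slope at most `1 - 2d`.
  let L : ℝ → ℝ := fun d => 4 * d + (π + d) / (1 - 2 * d)
  have hL : ContinuousAt L 0 := by
    refine ContinuousAt.add (by fun_prop) (ContinuousAt.div (by fun_prop) (by fun_prop) ?_)
    norm_num
  have hL0 : L 0 = π := by simp [L]
  have hroom : ∀ᶠ d in nhds (0 : ℝ), L d < A - (π + d) - (2 * k - 1) * L d := by
    refine ContinuousAt.eventually_lt hL (by fun_prop) ?_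
    rw [hL0]; linarith
  have hbig : ∀ᶠ d in nhds (0 : ℝ), a < (1 - 4 * d) * (2 * k * (A - (π + d))
      - 2 * (k : ℝ) ^ 2 * L d - (2 * k - 2) * L d - 2 * k * d) := by
    refine ContinuousAt.eventually_lt continuousAt_const (by fun_prop) ?_
    rw [hL0]; linarith
  have hsmall : ∀ᶠ d in nhds (0 : ℝ), d < 1 / 5 := eventually_lt_nhds (by norm_num)
  have hpos : ∀ᶠ d in nhdsWithin (0 : ℝ) (Set.Ioi 0), 0 < d := eventually_mem_nhdsWithin
  obtain ⟨d, ⟨⟨h1, h2⟩, h3⟩, hd⟩ :=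
    ((((hroom.and hbig).and hsmall).filter_mono nhdsWithin_le_nhds).and hpos).exists
  have hw : 0 < π + d := by linarith [Real.pi_pos]
  have hμ : 0 < 1 - 2 * d := by linarith
  have hwL : π + d ≤ (π + d) / (1 - 2 * d) := by
    rw [le_div_iff₀ hμ]; nlinarith
  obtain ⟨c, hc, hc0, hc1, hc'⟩ := exists_smooth_step hw hd hμ
  let D : FoldData :=
    { A := A, w := π + d, d := d, L := L d, k := k, c := c, one_le_k := hk, d_pos := hd
      five_d_lt := by linarith
      w_pos := hw
      w_le := by simp only [L]; linarith
      d_lt := by simp only [L]; linarith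
      L_lt := h1
      contDiff_c := hc
      c_eq_zero := hc0
      c_eq_w := hc1
      deriv_c := hc' }
  exact D.symplecticallyEmbeds ha (lt_add_of_pos_right π hd) h2

theorem mainTheorem9 (a ε : ℝ) (ha : 2 * π < a) (hε : 0 < ε) :
    SymplecticallyEmbeds (polydisc ![π, a]) (symplecticBall 2 (sPB a + ε)) := by
  obtain ⟨k, hk, -⟩ := existsUnique_isFoldIndex ha
  have hpi := Real.pi_pos
  rw [sPB_eq ha hk]
  obtain ⟨hk1, hlow, -⟩ := hk
  have hk0 : (0 : ℝ) < k := by exact_mod_cast hk1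
  rw [lt_div_iff₀ hpi] at hlow
  refine symplecticallyEmbeds_polydisc_ball (by linarith) hk1 ?_ ?_
  · have : ((k : ℝ) - 1) * π < (a - 2 * π) / (2 * k) := by
      rw [lt_div_iff₀ (by positivity)]
      linarith
    linarith
  -- `sPB a` solves the area condition with equality, and `ε` adds a surplus of `2kε`.
  · have : 2 * (k : ℝ) * ((a - 2 * π) / (2 * k)) = a - 2 * π := by field_simp
    have : 0 < (k : ℝ) * ε := by positivity
    linarith
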